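/- Let $A$ and $B, B_1, B_2, \dots$ be random variables with values in $\{0,1,2,\dots\}$, where $B_1,B_2,\dots$ are i.i.d. copies of $B$ that are independent of $A$, and let $X$ be a random variable with values in $\{0,1,2,\dots\}$, independent of $(A,B_1,B_2,\dots)$, that solves $$X =_{st} A+\sum_{i=1}^{X}B_i .$$ Assume $0<P(A=0)<1$, $P(B=0)<1$ and $0<b:=E(B)<1$. For a probability distribution $F$ on $\mathbb R$ write $\overline F(x)=F((x,\infty))$, and write $f(x)\sim g(x)$ for $f(x)/g(x)\to1$ as $x\to\infty$. $F$ is long-tailed ($F\in\mathcal L$) if $\overline F(x+y)\sim\overline F(x)$ for every $y$; dominantly varying ($F\in\mathcal D$) if $\liminf_{x\to\infty}\overline F(yx)/\overline F(x)>0$ for some $y>1$; subexponential if $F\in\mathcal L$ and $\overline{F*F}(x)\sim2\overline F(x)$; extended regularly varying ($F\in\mathcal{ERV}$) if for some $\alpha_+,\alpha_->0$ $$y^{-\alpha_-}\le\liminf_{x\to\infty}\frac{\overline F(yx)}{\overline F(x)}\le\limsup_{x\to\infty}\frac{\overline F(yx)}{\overline F(x)}\le y^{-\alpha_+}\qquad\text{for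 all } y\ge1;$$ regularly varying with parameter $\alpha>0$ if $\overline F(x)=x^{-\alpha}L(x)$ for $x>0$, where $L(cx)\sim L(x)$ for every $c>1$. Let $G\in\mathcal D\cap\mathcal L$ be a probability distribution on $\mathbb R$ and suppose that, for some constant $c_1>0$, $$\lim_{x\to\infty}\frac{P(A>x)}{\overline G(x)}=c_1,\qquad \lim_{x\to\infty}\frac{P(B>x)}{\overline G(x)}=0 .$$ Suppose also that $E(A)=\infty$ but $E(\log\max(A,1))<\infty$, and that at least one of the following holds: (I) $\operatorname{Var}(B)<\infty$ and $\liminf_{x\to\infty}x\,\overline G(x)\in(0,\infty]$; (II) the distribution $H_I$ with distribution function $H_I(x)=1-\min\bigl(1,\int_x^\infty P(B>u)\,du\bigr)$ is subexponential, and $\limsup_{x\to\infty}\overline{H_I}(x)/\overline G(x)<\infty$. For $c>1$ and $x>0$ let $T_c(x)=\sum_{n=0}^\infty\overline G(c^nx)$. Then all these series converge, and the following hold. (a) If, with $c_0=1/b$, $$\lim_{c\uparrow c_0}\limsup_{x\to\infty}\frac{T_c(x)}{T_{c_0}(x)}=\lim_{c\downarrow c_0}\liminf_{x\to\infty}\frac{T_c(x)}{T_{c_0}(x)}=1,$$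 then $P(X>x)\sim c_1\,T_{1/b}(x)$. (b) If $G\in\mathcal{ERV}$, then $P(X>x)\sim c_1\,T_{1/b}(x)$. (c) If $G$ is regularly varying with parameter $\alpha>0$, then $P(X>x)\sim \dfrac{c_1}{1-b^{\alpha}}\,\overline G(x)$. -/

import Mathlib

open MeasureTheory ProbabilityTheory Filter Topology Set

noncomputable section

namespace HeavyTail

/-- The tail `x ↦ F((x, ∞))` of a distribution `F` on the real line. -/
def tail (F : Measure ℝ) (x : ℝ) : ℝ := F.real (Ioi x)

/-- The tail `x ↦ P(Z > x)` of a random variable `Z` with values in the non-negative integers. -/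
def tailOf {Ω : Type*} [MeasurableSpace Ω] (P : Measure Ω) (Z : Ω → ℕ) (x : ℝ) : ℝ :=
  P.real {ω | x < (Z ω : ℝ)}

/-- Asymptotic equivalence at infinity: `f(x) / g(x) → 1` as `x → ∞`. -/
def AsympEquiv (f g : ℝ → ℝ) : Prop :=
  Tendsto (fun x => f x / g x) atTop (𝓝 1)

/-- Long-tailed distributions. -/
def LongTailed (F : Measure ℝ) : Prop :=
  ∀ y : ℝ, AsympEquiv (fun x => tail F (x + y)) (tail F)

/-- Dominantly varying distributions. -/
def DominantlyVarying (F : Measure ℝ) : Prop :=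
  ∃ y : ℝ, 1 < y ∧
    0 < liminf (fun x : ℝ => ((tail F (y * x) / tail F x : ℝ) : EReal)) atTop

/-- Subexponential distributions (on the whole real line): long-tailed, and the tail of the
convolution square is asymptotically twice the tail. -/
def Subexponential (F : Measure ℝ) : Prop :=
  LongTailed F ∧ AsympEquiv (tail (F.conv F)) (fun x => 2 * tail F x)

/-- Extended regularly varying distributions. -/
def ExtendedRegularlyVarying (F : Measure ℝ) : Prop :=
  ∃ αp αm : ℝ, 0 < αp ∧ 0 < αm ∧ ∀ y : ℝ, 1 ≤ y →
    ((y ^ (-αm) : ℝ) : EReal) ≤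
        liminf (fun x : ℝ => ((tail F (y * x) / tail F x : ℝ) : EReal)) atTop ∧
    limsup (fun x : ℝ => ((tail F (y * x) / tail F x : ℝ) : EReal)) atTop ≤
        ((y ^ (-αp) : ℝ) : EReal)

/-- Slowly varying functions. -/
def SlowlyVarying (L : ℝ → ℝ) : Prop :=
  ∀ c : ℝ, 1 < c → AsympEquiv (fun x => L (c * x)) L

/-- Regularly varying distributions with parameter `α` (used for `α > 0`). -/
def RegularlyVarying (F : Measure ℝ) (α : ℝ) : Prop :=
  ∃ L : ℝ → ℝ, SlowlyVarying L ∧ ∀ x : ℝ, 0 < x → tail F x = x ^ (-α) * L x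

/-- The truncated integrated tail `min(1, ∫_x^∞ F((u, ∞)) du)`. -/
def truncIntegratedTail (F : Measure ℝ) (x : ℝ) : ℝ :=
  (min 1 (∫⁻ u in Ioi x, F (Ioi u))).toReal

theorem truncIntegratedTail_antitone (F : Measure ℝ) : Antitone (truncIntegratedTail F) := by
  intro x y hxy
  refine ENNReal.toReal_mono (ne_top_of_le_ne_top ENNReal.one_ne_top (min_le_left _ _)) ?_
  exact min_le_min le_rfl (lintegral_mono_set (Ioi_subset_Ioi hxy))

theorem truncIntegratedTail_rightCont (F : Measure ℝ) (x : ℝ) :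
    ContinuousWithinAt (truncIntegratedTail F) (Ici x) x := by
  set g : ℝ → ENNReal := fun x => ∫⁻ u in Ioi x, F (Ioi u) with hg
  have hanti : Antitone g := fun a b hab => lintegral_mono_set (Ioi_subset_Ioi hab)
  have hgx : Tendsto g (𝓝[>] x) (𝓝 (g x)) := by
    have h1 : Tendsto g (𝓝[>] x) (𝓝 (sSup (g '' Ioi x))) := hanti.tendsto_nhdsGT x
    have h2 : sSup (g '' Ioi x) = g x := by
      apply le_antisymm
      · apply sSup_le
        rintro _ ⟨y, hy, rfl⟩
        exact hanti (le_of_lt hy)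
      · obtain ⟨u, hu, hux, hlim⟩ := exists_seq_strictAnti_tendsto x
        have hU : Ioi x = ⋃ n, Ioi (u n) := by
          ext z
          simp only [mem_Ioi, mem_iUnion]
          constructor
          · intro hz
            exact (hlim.eventually (gt_mem_nhds hz)).exists
          · rintro ⟨n, hn⟩
            exact (hux n).trans hn
        have hm : Monotone fun n => Ioi (u n) := fun a b hab => Ioi_subset_Ioi (hu.antitone hab)
        have : g x = ⨆ n, g (u n) := by
          simp only [hg]
          rw [hU, setLIntegral_iUnion_of_directed _ hm.directed_le]
        rw [this]
        exact iSup_le fun n => le_sSup ⟨u n, hux n, rfl⟩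
    rwa [h2] at h1
  rw [← continuousWithinAt_Ioi_iff_Ici]
  have hmin : Tendsto (fun y => min 1 (g y)) (𝓝[>] x) (𝓝 (min 1 (g x))) :=
    tendsto_const_nhds.min hgx
  exact (ENNReal.tendsto_toReal
    (ne_top_of_le_ne_top ENNReal.one_ne_top (min_le_left _ _))).comp hmin

/-- The integrated tail distribution of `F`: the distribution on the real line with distribution
function `x ↦ 1 - min(1, ∫_x^∞ F((u, ∞)) du)`. -/
def integratedTailDistribution (F : Measure ℝ) : Measure ℝ :=
  StieltjesFunction.measure
    { toFun := fun x => 1 - truncIntegratedTail F x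
      mono' := fun _ _ h => sub_le_sub_left (truncIntegratedTail_antitone F h) 1
      right_continuous' := fun x =>
        continuousWithinAt_const.sub (truncIntegratedTail_rightCont F x) }

/-- The function `T_c(x) = ∑_{n ≥ 0} F((cⁿ x, ∞))`. -/
def tailSeries (F : Measure ℝ) (c x : ℝ) : ℝ := ∑' n : ℕ, tail F (c ^ n * x)

/-- Continuity of `c ↦ T_c` at `c₀`, relative to `T_{c₀}` and asymptotically in `x`:
`lim_{c ↑ c₀} limsup_{x → ∞} T_c(x) / T_{c₀}(x) = lim_{c ↓ c₀} liminf_{x → ∞} T_c(x) / T_{c₀}(x)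
= 1`. -/
def TailSeriesContinuousAt (F : Measure ℝ) (c₀ : ℝ) : Prop :=
  Tendsto (fun c : ℝ =>
      limsup (fun x : ℝ => ((tailSeries F c x / tailSeries F c₀ x : ℝ) : EReal)) atTop)
    (𝓝[<] c₀) (𝓝 1) ∧
  Tendsto (fun c : ℝ =>
      liminf (fun x : ℝ => ((tailSeries F c x / tailSeries F c₀ x : ℝ) : EReal)) atTop)
    (𝓝[>] c₀) (𝓝 1)

/-- `X` solves `X =_st A + ∑_{i=1}^X B_i`, where `B_1, B_2, …` (here `B 0, B 1, …`) are i.i.d.,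
independent of `A`, and `X` is independent of `(A, B_1, B_2, …)`. -/
structure IsFixedPointSolution {Ω : Type*} [MeasurableSpace Ω] (P : Measure Ω)
    (A : Ω → ℕ) (B : ℕ → Ω → ℕ) (X : Ω → ℕ) : Prop where
  measurable_A : Measurable A
  measurable_B : ∀ i, Measurable (B i)
  measurable_X : Measurable X
  iIndep_B : iIndepFun B P
  identDistrib_B : ∀ i, IdentDistrib (B i) (B 0) P P
  indep_A_B : IndepFun A (fun ω i => B i ω) P
  indep_X : IndepFun X (fun ω => (A ω, fun i => B i ω)) P
  fixedPoint : IdentDistrib X (fun ω => A ω + ∑ i ∈ Finset.range (X ω), B i ω) P P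

end HeavyTail

end

namespace HeavyTail

/-! Write `a(x) = P(A > x)`, `f(x) = P(X > x)` and let `S` be the random sum of `X` copies of `B`.
For large `x`, `A + S > x` happens essentially when `A > x`, or when `S > x`; by the law of large
numbers the latter means `X > x/b`. Thus `f(x) ≈ a(x) + f(x/b)`, and iteration gives `f(x) ≈ ∑ a(b⁻ⁿ
x) ≈ c₁ T_{1/b}(x)`.

To make this rigorous, `1/b` is replaced by a nearby `c`. For `c < 1/b`, `f(x) ≤ (1 + ε) c₁ tail G x
+ f(c x)` (`upper_bound`); for `c > 1/b`, `f(x) ≥ a(x) + (1 - a(x) - D/x) f(c x)`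
(`lower_recursion`). Iterating bounds `f` between multiples of `T_c`, and `c → 1/b` is harmless when
`T_c` is continuous in `c` at `1/b` (assumed in (a), proved for extended regular variation). Under
regular variation the series is asymptotically geometric.

The delicate point is the upper recursion: a sum of at most `c x` summands exceeds `z x`, with `c b
< z < 1`, only with probability `o(tail G x)` (`tendsto_prob_few_summands`). This is dominated
convergence over the value of `X`, the domination coming from `exists_uniform_bound`: a union bound
for one large summand plus a Chernoff bound for truncated summands. Conditions (I) and (II) both
enter through `t P(B > t) ≤ C tail G t`. -/

lemma tail_antitone (F : Measure ℝ) [IsFiniteMeasure F] : Antitone (tail F) :=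
  fun _ _ h => measureReal_mono (Ioi_subset_Ioi h)

lemma tail_nonneg (F : Measure ℝ) (x : ℝ) : 0 ≤ tail F x := measureReal_nonneg

lemma tail_le_one (F : Measure ℝ) [IsProbabilityMeasure F] (x : ℝ) : tail F x ≤ 1 :=
  measureReal_le_one

lemma tail_tendsto_zero (F : Measure ℝ) [IsProbabilityMeasure F] :
    Tendsto (tail F) atTop (𝓝 0) := by
  have h : tail F = fun x => 1 - cdf F x := by
    funext x
    rw [cdf_eq_real, tail, ← compl_Iic, measureReal_compl measurableSet_Iic]
    simp
  rw [h]
  simpa using (tendsto_cdf_atTop F).const_sub 1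

lemma tailOf_eq_tail {Ω : Type*} [MeasurableSpace Ω] (P : Measure Ω) {Z : Ω → ℕ}
    (hZ : Measurable Z) (x : ℝ) : tailOf P Z x = tail (P.map fun ω => (Z ω : ℝ)) x := by
  have : Measurable fun ω => (Z ω : ℝ) := by fun_prop
  rw [tail, map_measureReal_apply this measurableSet_Ioi]
  rfl

lemma isProbabilityMeasure_map_cast {Ω : Type*} [MeasurableSpace Ω] (P : Measure Ω)
    [IsProbabilityMeasure P] {Z : Ω → ℕ} (hZ : Measurable Z) :
    IsProbabilityMeasure (P.map fun ω => (Z ω : ℝ)) :=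
  Measure.isProbabilityMeasure_map (by fun_prop)

lemma tailOf_antitone {Ω : Type*} [MeasurableSpace Ω] (P : Measure Ω) [IsFiniteMeasure P]
    (Z : Ω → ℕ) : Antitone (tailOf P Z) :=
  fun _ _ h => measureReal_mono fun _ hω => lt_of_le_of_lt h hω

lemma tailOf_nonneg {Ω : Type*} [MeasurableSpace Ω] (P : Measure Ω)
    (Z : Ω → ℕ) (x : ℝ) : 0 ≤ tailOf P Z x := measureReal_nonneg

lemma tailOf_le_one {Ω : Type*} [MeasurableSpace Ω] (P : Measure Ω) [IsProbabilityMeasure P]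
    (Z : Ω → ℕ) (x : ℝ) : tailOf P Z x ≤ 1 := measureReal_le_one

lemma tailOf_tendsto_zero {Ω : Type*} [MeasurableSpace Ω] (P : Measure Ω)
    [IsProbabilityMeasure P] {Z : Ω → ℕ} (hZ : Measurable Z) :
    Tendsto (tailOf P Z) atTop (𝓝 0) := by
  have := isProbabilityMeasure_map_cast P hZ
  rw [funext (tailOf_eq_tail P hZ)]
  exact tail_tendsto_zero _

/-! ### Dominant variation -/

lemma DominantlyVarying.exists_ratio {F : Measure ℝ} (hF : DominantlyVarying F) :
    ∃ q κ : ℝ, 1 < q ∧ 0 < κ ∧ ∀ᶠ x in atTop, κ < tail F (q * x) / tail F x := by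
  obtain ⟨q, hq, h⟩ := hF
  obtain ⟨κ, hκ0, hκ⟩ := EReal.lt_iff_exists_real_btwn.1 h
  refine ⟨q, κ, hq, by exact_mod_cast hκ0, ?_⟩
  filter_upwards [eventually_lt_of_lt_liminf hκ] with x hx
  exact_mod_cast hx

lemma DominantlyVarying.tail_pos {F : Measure ℝ} [IsFiniteMeasure F] (hF : DominantlyVarying F)
    (x : ℝ) : 0 < tail F x := by
  obtain ⟨q, κ, hq, hκ, h⟩ := hF.exists_ratio
  obtain ⟨z, hz, hxz⟩ := (h.and (eventually_ge_atTop x)).exists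
  refine lt_of_lt_of_le ?_ (tail_antitone F hxz)
  rcases (tail_nonneg F z).lt_or_eq with h0 | h0
  · exact h0
  -- A zero tail at `z` makes the ratio a quotient by zero, which evaluates to 0 and cannot exceed
  -- `κ`.
  · rw [← h0, div_zero] at hz
    exact absurd hz hκ.not_gt

lemma DominantlyVarying.exists_step {F : Measure ℝ} [IsProbabilityMeasure F]
    (hF : DominantlyVarying F) :
    ∃ q K : ℝ, 1 < q ∧ 1 ≤ K ∧ ∀ x, 0 < x → tail F x ≤ K * tail F (q * x) := by
  obtain ⟨q, κ, hq, hκ, h⟩ := hF.exists_ratio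
  obtain ⟨x₀, hx₀⟩ := eventually_atTop.1 h
  have hpos := hF.tail_pos
  -- The term `κ⁻¹` serves `x ≥ x₀`. Below `x₀` the left tail is at most 1 and the right tail at
  -- least `tail F (q * x₀) > 0`, so the bound holds for every positive `x`.
  refine ⟨q, max 1 (max κ⁻¹ (tail F (q * x₀))⁻¹), hq, le_max_left _ _, fun x hx => ?_⟩
  rcases le_total x₀ x with hxx | hxx
  · have h1 := (lt_div_iff₀ (hpos x)).1 (hx₀ x hxx)
    calc tail F x = κ⁻¹ * (κ * tail F x) := by field_simp
      _ ≤ κ⁻¹ * tail F (q * x) := by gcongr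
      _ ≤ _ := by
        gcongr
        · exact tail_nonneg _ _
        · exact (le_max_left _ _).trans (le_max_right _ _)
  · calc tail F x ≤ 1 := tail_le_one F x
      _ = (tail F (q * x₀))⁻¹ * tail F (q * x₀) := (inv_mul_cancel₀ (hpos _).ne').symm
      _ ≤ (tail F (q * x₀))⁻¹ * tail F (q * x) := by
        gcongr
        · exact inv_nonneg.2 (tail_nonneg _ _)
        · exact tail_antitone F (by gcongr)
      _ ≤ _ := by
        gcongr
        · exact tail_nonneg _ _
        · exact (le_max_right _ _).trans (le_max_right _ _)

/-- A Potter-type bound for dominantly varying tails. -/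
lemma DominantlyVarying.potter {F : Measure ℝ} [IsProbabilityMeasure F]
    (hF : DominantlyVarying F) :
    ∃ K α : ℝ, 1 ≤ K ∧ 1 ≤ α ∧ ∀ t s, 0 < t → t ≤ s → tail F t ≤ K * (s / t) ^ α * tail F s := by
  obtain ⟨q, K, hq, hK, h⟩ := hF.exists_step
  have hK0 : 0 < K := by linarith
  have hq0 : 0 < q := by linarith
  have hpow : ∀ n : ℕ, ∀ x, 0 < x → tail F x ≤ K ^ n * tail F (q ^ n * x) := by
    intro n
    induction n with
    | zero => intro x _; simp
    | succ n ih =>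
      intro x hx
      calc tail F x ≤ K ^ n * tail F (q ^ n * x) := ih x hx
        _ ≤ K ^ n * (K * tail F (q * (q ^ n * x))) := by gcongr; exact h _ (by positivity)
        _ = _ := by rw [pow_succ, mul_assoc, ← mul_assoc q, ← pow_succ']
  -- With `q ^ n ≤ s / t < q ^ (n + 1)`, the `n + 1` steps cost `K * K ^ n`, and `K ^ n = (q ^ n) ^
  -- logb q K` is at most a power of `s / t`.
  refine ⟨K, max 1 (Real.logb q K), hK, le_max_left _ _, fun t s ht hts => ?_⟩
  have hst : 1 ≤ s / t := (one_le_div ht).2 hts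
  obtain ⟨n, hn1, hn2⟩ := exists_nat_pow_near hst hq
  have h1 : K ^ n ≤ (s / t) ^ max 1 (Real.logb q K) := by
    calc K ^ n = (q ^ n) ^ Real.logb q K := by
          rw [← Real.rpow_natCast q, ← Real.rpow_mul hq0.le, mul_comm, Real.rpow_mul hq0.le,
            Real.rpow_logb hq0 hq.ne' hK0, Real.rpow_natCast]
      _ ≤ (s / t) ^ Real.logb q K :=
          Real.rpow_le_rpow (by positivity) hn1 (Real.logb_nonneg hq hK)
      _ ≤ _ := Real.rpow_le_rpow_of_exponent_le hst (le_max_right _ _)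
  calc tail F t ≤ K ^ (n + 1) * tail F (q ^ (n + 1) * t) := hpow _ t ht
    _ ≤ K ^ (n + 1) * tail F s := by
        gcongr
        exact tail_antitone F ((div_lt_iff₀ ht).1 hn2).le
    _ = K * K ^ n * tail F s := by ring
    _ ≤ _ := by
        gcongr
        exact tail_nonneg _ _

lemma DominantlyVarying.tail_mul_le {F : Measure ℝ} [IsProbabilityMeasure F]
    (hF : DominantlyVarying F) {l : ℝ} (hl : 0 < l) :
    ∃ C : ℝ, 0 < C ∧ ∀ x, 0 < x → tail F (l * x) ≤ C * tail F x := by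
  obtain ⟨K, α, hK, hα, h⟩ := hF.potter
  rcases le_total 1 l with h1 | h1
  · refine ⟨1, one_pos, fun x hx => ?_⟩
    rw [one_mul]
    exact tail_antitone F (by nlinarith)
  · refine ⟨K * l⁻¹ ^ α, by positivity, fun x hx => ?_⟩
    have := h (l * x) x (by positivity) (by nlinarith)
    rwa [show x / (l * x) = l⁻¹ by field_simp] at this

/-! ### Geometric series of tails -/

lemma summable_of_eventually_le {u : ℝ → ℝ} {v : ℝ → ℝ} {C : ℝ} (hu : ∀ x, 0 ≤ u x)
    (huv : ∀ᶠ x in atTop, u x ≤ C * v x) {c x : ℝ} (hc : 1 < c) (hx : 0 < x)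
    (hv : Summable fun n : ℕ => v (c ^ n * x)) : Summable fun n : ℕ => u (c ^ n * x) := by
  have ht : Tendsto (fun n : ℕ => c ^ n * x) atTop atTop :=
    (tendsto_pow_atTop_atTop_of_one_lt hc).atTop_mul_const hx
  refine Summable.of_norm_bounded_eventually_nat (hv.mul_left C) ?_
  filter_upwards [ht.eventually huv] with n hn
  rwa [Real.norm_of_nonneg (hu _)]

/-- `A > c ^ n` says that `log (max A 1) / log c` exceeds `n`, and the tails of an integrable
non-negative variable are summable over the integers. -/
lemma summable_tailOf_of_integrable_log {Ω : Type*} [MeasurableSpace Ω] (P : Measure Ω)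
    [IsProbabilityMeasure P] {A : Ω → ℕ}
    (hlog : Integrable (fun ω => Real.log (max (A ω : ℝ) 1)) P) {c x : ℝ} (hc : 1 < c)
    (hx : 0 < x) : Summable fun n : ℕ => tailOf P A (c ^ n * x) := by
  have hlc : 0 < Real.log c := Real.log_pos hc
  have h1 : Summable fun n : ℕ => tailOf P A (c ^ n) := by
    have hfin := @tsum_prob_mem_Ioi_lt_top Ω ⟨P⟩ _ (fun ω => Real.log (max (A ω : ℝ) 1) / Real.log c)
      (hlog.div_const _) (fun ω => div_nonneg (Real.log_nonneg (le_max_right _ _)) hlc.le)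
    refine Summable.of_nonneg_of_le (fun n => tailOf_nonneg P A _) (fun n => ?_)
      (ENNReal.summable_toReal hfin.ne)
    refine measureReal_mono (fun ω hω => ?_)
    simp only [mem_ofPred_eq, mem_Ioi] at hω ⊢
    rw [lt_div_iff₀ hlc, ← Real.log_pow]
    exact Real.log_lt_log (by positivity) (hω.trans_le (le_max_left _ _))
  -- Dropping the first `m` terms, where `c ^ m * x ≥ 1`, reduces a general `x` to `x = 1`.
  obtain ⟨m, hm⟩ := (tendsto_pow_atTop_atTop_of_one_lt hc).eventually_ge_atTop x⁻¹ |>.exists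
  rw [← summable_nat_add_iff m]
  refine Summable.of_nonneg_of_le (fun n => tailOf_nonneg P A _) (fun n => ?_) h1
  refine tailOf_antitone P A ?_
  have : 1 ≤ c ^ m * x := by
    calc (1:ℝ) = x⁻¹ * x := (inv_mul_cancel₀ hx.ne').symm
      _ ≤ _ := by gcongr
  rw [pow_add, mul_assoc]
  exact le_mul_of_one_le_right (by positivity) this

lemma tailSeries_nonneg (F : Measure ℝ) (c x : ℝ) : 0 ≤ tailSeries F c x :=
  tsum_nonneg fun _ => tail_nonneg _ _

lemma tail_le_tailSeries {F : Measure ℝ} {c x : ℝ}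
    (h : Summable fun n : ℕ => tail F (c ^ n * x)) : tail F x ≤ tailSeries F c x := by
  simpa [tailSeries] using h.le_tsum 0 (fun _ _ => tail_nonneg _ _)

lemma tailSeries_tendsto_zero {F : Measure ℝ} [IsProbabilityMeasure F] {c : ℝ} (hc : 1 < c)
    (h : ∀ x, 0 < x → Summable fun n : ℕ => tail F (c ^ n * x)) :
    Tendsto (tailSeries F c) atTop (𝓝 0) := by
  have : Tendsto (fun x => ∑' n : ℕ, tail F (c ^ n * x)) atTop (𝓝 (∑' _ : ℕ, (0:ℝ))) := by
    refine tendsto_tsum_of_dominated_convergence (h 1 one_pos) (fun n => ?_) ?_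
    · exact (tail_tendsto_zero F).comp (tendsto_id.const_mul_atTop (by positivity))
    · filter_upwards [eventually_ge_atTop 1] with x hx n
      rw [Real.norm_of_nonneg (tail_nonneg _ _)]
      exact tail_antitone F (by gcongr)
  rw [tsum_zero] at this
  exact this

lemma le_mul_pow {c x x₀ : ℝ} (hc : 1 < c) (hx₀ : 0 < x₀) (hx : x₀ ≤ x) (n : ℕ) :
    x₀ ≤ c ^ n * x :=
  hx.trans (le_mul_of_one_le_left (by linarith) (one_le_pow₀ hc.le))

/-! ### Iterating one-step inequalities along `cⁿ x`, and letting `c` tend to `c₀` -/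

lemma le_tailSeries_of_recursion {F : Measure ℝ} {f : ℝ → ℝ} {c κ x₀ : ℝ} (hc : 1 < c)
    (hx₀ : 0 < x₀) (hκ : 0 ≤ κ) (hf : Tendsto f atTop (𝓝 0))
    (h : ∀ x, 0 < x → Summable fun n : ℕ => tail F (c ^ n * x))
    (hrec : ∀ x, x₀ ≤ x → f x ≤ κ * tail F x + f (c * x)) {x : ℝ} (hx : x₀ ≤ x) :
    f x ≤ κ * tailSeries F c x := by
  have hxp : 0 < x := by linarith
  have key : ∀ N : ℕ, f x ≤ κ * (∑ n ∈ Finset.range N, tail F (c ^ n * x)) + f (c ^ N * x) := by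
    intro N
    induction N with
    | zero => simp
    | succ N ih =>
      have := hrec (c ^ N * x) (le_mul_pow hc hx₀ hx N)
      rw [Finset.sum_range_succ, pow_succ', mul_assoc]
      linarith
  have ht : Tendsto (fun N : ℕ => κ * tailSeries F c x + f (c ^ N * x)) atTop
      (𝓝 (κ * tailSeries F c x + 0)) :=
    (hf.comp ((tendsto_pow_atTop_atTop_of_one_lt hc).atTop_mul_const hxp)).const_add _
  rw [add_zero] at ht
  refine ge_of_tendsto' ht fun N => (key N).trans ?_
  gcongr
  exact (h x hxp).sum_le_tsum _ fun _ _ => tail_nonneg _ _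

/-- Unrolling the recursion produces products of factors `1 - e(cᵏ x)`; each is bounded below by one
minus the sum of the errors, so only that sum has to be controlled. -/
lemma sum_le_of_recursion {f a e : ℝ → ℝ} {c x₀ : ℝ} (hc : 1 < c) (hx₀ : 0 < x₀)
    (hf : ∀ x, 0 ≤ f x) (ha : ∀ x, 0 ≤ a x) (he : ∀ x, x₀ ≤ x → 0 ≤ e x)
    (hrec : ∀ x, x₀ ≤ x → a x + (1 - e x) * f (c * x) ≤ f x) (N : ℕ) :
    ∀ x, x₀ ≤ x → (1 - ∑ n ∈ Finset.range N, e (c ^ n * x)) *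
      (∑ n ∈ Finset.range N, a (c ^ n * x)) ≤ f x := by
  induction N with
  | zero => intro x _; simpa using hf x
  | succ N ih =>
    intro x hx
    have hxp : 0 < x := by linarith
    have h1 := ih (c * x) (by simpa using le_mul_pow hc hx₀ hx 1)
    simp only [← mul_assoc, ← pow_succ] at h1
    have hE : 0 ≤ ∑ n ∈ Finset.range N, e (c ^ (n + 1) * x) :=
      Finset.sum_nonneg fun n _ => he _ (le_mul_pow hc hx₀ hx _)
    have hS : 0 ≤ ∑ n ∈ Finset.range N, a (c ^ (n + 1) * x) := Finset.sum_nonneg fun n _ => ha _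
    have he0 := he x hx
    have ha0 := ha x
    have hr := hrec x hx
    rw [Finset.sum_range_succ', Finset.sum_range_succ' (fun n => a (c ^ n * x))]
    simp only [pow_zero, one_mul]
    set E := ∑ n ∈ Finset.range N, e (c ^ (n + 1) * x)
    set S := ∑ n ∈ Finset.range N, a (c ^ (n + 1) * x)
    -- If `1 - e x ≤ 0`, the recursion cannot be combined with the induction hypothesis, but then
    -- the left side is non-positive.
    rcases le_total (1 - e x) 0 with h0 | h0
    · exact (mul_nonpos_of_nonpos_of_nonneg (by linarith) (by linarith)).trans (hf x)
    · have h2 : (1 - e x) * ((1 - E) * S) ≤ (1 - e x) * f (c * x) := by gcongr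
      nlinarith [mul_nonneg (mul_nonneg he0 hE) hS, mul_nonneg he0 ha0, mul_nonneg hE ha0]

lemma tailSeries_le_of_recursion {F : Measure ℝ} [IsProbabilityMeasure F] {f a : ℝ → ℝ}
    {c D c₁ ε : ℝ} (hc : 1 < c) (hc₁ : 0 < c₁) (hε : 0 < ε) (hε1 : ε < 1)
    (h : ∀ x, 0 < x → Summable fun n : ℕ => tail F (c ^ n * x))
    (hf : ∀ x, 0 ≤ f x) (ha : ∀ x, 0 ≤ a x) (hFpos : ∀ x, 0 < tail F x)
    (hlim : Tendsto (fun x => a x / tail F x) atTop (𝓝 c₁)) (hD : 0 ≤ D)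
    (hrec : ∀ᶠ x in atTop, a x + (1 - (a x + D / x)) * f (c * x) ≤ f x) :
    ∀ᶠ x in atTop, (1 - ε) * c₁ * tailSeries F c x ≤ f x := by
  have hup : ∀ᶠ x in atTop, a x ≤ 2 * c₁ * tail F x := by
    filter_upwards [hlim.eventually_lt_const (show c₁ < 2 * c₁ by linarith)] with x hx
    exact ((div_lt_iff₀ (hFpos x)).1 hx).le
  have hlo : ∀ᶠ x in atTop, (1 - ε / 2) * c₁ * tail F x ≤ a x := by
    filter_upwards [hlim.eventually_const_lt (show (1 - ε / 2) * c₁ < c₁ by nlinarith)] with x hx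
    exact ((lt_div_iff₀ (hFpos x)).1 hx).le
  obtain ⟨x₁, hx₁⟩ := eventually_atTop.1 (hup.and (hlo.and hrec))
  set x₀ := max x₁ 1 with hx₀def
  have hx₀ : 0 < x₀ := by positivity
  -- This bounds the accumulated error `∑ (a + D/x)` along `cⁿ x`: the first part by a multiple of
  -- `T_c(x)`, the second by a geometric series. Both vanish as `x → ∞`.
  have herr : Tendsto (fun x => 2 * c₁ * tailSeries F c x + D / (1 - c⁻¹) * x⁻¹) atTop
      (𝓝 (2 * c₁ * 0 + D / (1 - c⁻¹) * 0)) :=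
    ((tailSeries_tendsto_zero hc h).const_mul _).add (tendsto_inv_atTop_zero.const_mul _)
  filter_upwards [herr.eventually_lt_const (show 2 * c₁ * 0 + D / (1 - c⁻¹) * 0 < ε / 2 by simpa),
    eventually_ge_atTop x₀] with x hx hxx
  have hxp : 0 < x := by linarith
  have hge : ∀ n : ℕ, x₁ ≤ c ^ n * x := fun n =>
    (le_max_left _ _).trans (le_mul_pow hc hx₀ hxx n)
  have hci : c⁻¹ < 1 := inv_lt_one_of_one_lt₀ hc
  have key : ∀ N : ℕ,
      (1 - ε) * c₁ * (∑ n ∈ Finset.range N, tail F (c ^ n * x)) ≤ f x := by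
    intro N
    have h1 := sum_le_of_recursion (e := fun x => a x + D / x) hc hx₀ hf ha
      (fun x hx => add_nonneg (ha x) (div_nonneg hD (hx₀.le.trans hx)))
      (fun x hx => (hx₁ x ((le_max_left _ _).trans hx)).2.2) N x hxx
    refine le_trans ?_ h1
    have hS : (1 - ε / 2) * c₁ * (∑ n ∈ Finset.range N, tail F (c ^ n * x)) ≤
        ∑ n ∈ Finset.range N, a (c ^ n * x) := by
      rw [Finset.mul_sum]
      exact Finset.sum_le_sum fun n _ => (hx₁ _ (hge n)).2.1
    have hE : ∑ n ∈ Finset.range N, (a (c ^ n * x) + D / (c ^ n * x)) ≤ ε / 2 := by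
      refine le_trans ?_ hx.le
      rw [Finset.sum_add_distrib]
      gcongr
      · calc _ ≤ ∑ n ∈ Finset.range N, 2 * c₁ * tail F (c ^ n * x) :=
              Finset.sum_le_sum fun n _ => (hx₁ _ (hge n)).1
          _ = 2 * c₁ * ∑ n ∈ Finset.range N, tail F (c ^ n * x) := (Finset.mul_sum _ _ _).symm
          _ ≤ _ := by
            gcongr
            exact (h x hxp).sum_le_tsum _ fun _ _ => tail_nonneg _ _
      · have hg := summable_geometric_of_lt_one (by positivity) hci
        calc _ = D * x⁻¹ * ∑ n ∈ Finset.range N, c⁻¹ ^ n := by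
              rw [Finset.mul_sum]
              refine Finset.sum_congr rfl fun n _ => ?_
              rw [inv_pow]; field_simp
          _ ≤ D * x⁻¹ * (1 - c⁻¹)⁻¹ := by
              rw [← tsum_geometric_of_lt_one (by positivity) hci]
              gcongr
              exact hg.sum_le_tsum _ fun _ _ => by positivity
          _ = _ := by ring
    have hS0 : 0 ≤ ∑ n ∈ Finset.range N, tail F (c ^ n * x) :=
      Finset.sum_nonneg fun _ _ => tail_nonneg _ _
    have hA0 : 0 ≤ ∑ n ∈ Finset.range N, a (c ^ n * x) :=
      Finset.sum_nonneg fun _ _ => ha _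
    calc (1 - ε) * c₁ * (∑ n ∈ Finset.range N, tail F (c ^ n * x))
        ≤ (1 - ε / 2) * ((1 - ε / 2) * c₁ * (∑ n ∈ Finset.range N, tail F (c ^ n * x))) := by
          nlinarith [mul_nonneg (mul_nonneg hc₁.le hS0) (sq_nonneg ε)]
      _ ≤ (1 - ε / 2) * ∑ n ∈ Finset.range N, a (c ^ n * x) := by
          gcongr
          linarith
      _ ≤ _ := by
          gcongr
  have ht : Tendsto (fun N : ℕ => (1 - ε) * c₁ * (∑ n ∈ Finset.range N, tail F (c ^ n * x)))
      atTop (𝓝 ((1 - ε) * c₁ * tailSeries F c x)) :=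
    (h x hxp).hasSum.tendsto_sum_nat.const_mul _
  exact le_of_tendsto' ht key

lemma asympEquiv_of_sandwich {F : Measure ℝ} {f : ℝ → ℝ} {c₁ c₀ : ℝ} (hc₁ : 0 < c₁)
    (hT : ∀ᶠ x in atTop, 0 < tailSeries F c₀ x)
    (hup : ∀ c, 1 < c → c < c₀ → ∀ ε, 0 < ε →
      ∀ᶠ x in atTop, f x ≤ (1 + ε) * c₁ * tailSeries F c x)
    (hlo : ∀ c, c₀ < c → ∀ ε, 0 < ε → ε < 1 →
      ∀ᶠ x in atTop, (1 - ε) * c₁ * tailSeries F c x ≤ f x)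
    (h1 : ∀ ε, 0 < ε → ∃ c, 1 < c ∧ c < c₀ ∧
      ∀ᶠ x in atTop, tailSeries F c x ≤ (1 + ε) * tailSeries F c₀ x)
    (h2 : ∀ ε, 0 < ε → ε < 1 → ∃ c, c₀ < c ∧
      ∀ᶠ x in atTop, (1 - ε) * tailSeries F c₀ x ≤ tailSeries F c x) :
    AsympEquiv f (fun x => c₁ * tailSeries F c₀ x) := by
  refine tendsto_order.2 ⟨fun a ha => ?_, fun a ha => ?_⟩
  -- One factor `1 - ε` comes from the bound on `f`, another from replacing `T_c` by `T_{c₀}`; `(1 -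
  -- ε)² ≥ 1 - 2ε > a`.
  · set ε := min ((1 - a) / 3) (1 / 2) with hε
    have hε0 : 0 < ε := lt_min (by linarith) (by norm_num)
    have hε1 : ε < 1 := (min_le_right _ _).trans_lt (by norm_num)
    have hεa : ε ≤ (1 - a) / 3 := min_le_left _ _
    obtain ⟨c, hc, h⟩ := h2 ε hε0 hε1
    filter_upwards [hT, hlo c hc ε hε0 hε1, h] with x hx hx1 hx2
    rw [lt_div_iff₀ (by positivity)]
    have : (1 - ε) * c₁ * ((1 - ε) * tailSeries F c₀ x) ≤ f x := by
      refine le_trans ?_ hx1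
      have : 0 ≤ (1 - ε) * c₁ := mul_nonneg (by linarith) hc₁.le
      gcongr
    refine lt_of_lt_of_le ?_ this
    have hpos : 0 < c₁ * tailSeries F c₀ x := by positivity
    nlinarith [mul_nonneg (sq_nonneg ε) hpos.le]
  -- As `ε ≤ 1`, `(1 + ε)² ≤ 1 + 3ε < a`.
  · set ε := min ((a - 1) / 4) 1 with hε
    have hε0 : 0 < ε := lt_min (by linarith) (by norm_num)
    have hε1 : ε ≤ 1 := min_le_right _ _
    have hεa : ε ≤ (a - 1) / 4 := min_le_left _ _
    obtain ⟨c, hc1, hc, h⟩ := h1 ε hε0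
    filter_upwards [hT, hup c hc1 hc ε hε0, h] with x hx hx1 hx2
    rw [div_lt_iff₀ (by positivity)]
    have : f x ≤ (1 + ε) * c₁ * ((1 + ε) * tailSeries F c₀ x) := by
      refine hx1.trans ?_
      gcongr
    refine this.trans_lt ?_
    have hpos : 0 < c₁ * tailSeries F c₀ x := by positivity
    have h3 : (1 + ε) * (1 + ε) < a := by nlinarith
    nlinarith

lemma TailSeriesContinuousAt.exists_lt {F : Measure ℝ} {c₀ : ℝ} (h : TailSeriesContinuousAt F c₀)
    (hc₀ : 1 < c₀) (hT : ∀ᶠ x in atTop, 0 < tailSeries F c₀ x) {ε : ℝ} (hε : 0 < ε) :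
    ∃ c, 1 < c ∧ c < c₀ ∧ ∀ᶠ x in atTop, tailSeries F c x ≤ (1 + ε) * tailSeries F c₀ x := by
  have h1 : (1 : EReal) < ((1 + ε : ℝ) : EReal) := by exact_mod_cast (by linarith : (1:ℝ) < 1 + ε)
  obtain ⟨c, hc, hlt, h1c⟩ := ((h.1.eventually_lt_const h1).and
    ((eventually_mem_nhdsWithin (a := c₀) (s := Iio c₀)).and
      (eventually_nhdsWithin_of_eventually_nhds (eventually_gt_nhds hc₀)))).exists
  refine ⟨c, h1c, hlt, ?_⟩
  filter_upwards [eventually_lt_of_limsup_lt hc, hT] with x hx hx0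
  exact ((div_lt_iff₀ hx0).1 (by exact_mod_cast hx)).le

lemma TailSeriesContinuousAt.exists_gt {F : Measure ℝ} {c₀ : ℝ} (h : TailSeriesContinuousAt F c₀)
    (hT : ∀ᶠ x in atTop, 0 < tailSeries F c₀ x) {ε : ℝ} (hε : 0 < ε) :
    ∃ c, c₀ < c ∧ ∀ᶠ x in atTop, (1 - ε) * tailSeries F c₀ x ≤ tailSeries F c x := by
  have h1 : ((1 - ε : ℝ) : EReal) < (1 : EReal) := by exact_mod_cast (by linarith : 1 - ε < (1:ℝ))
  obtain ⟨c, hc, hlt⟩ := ((h.2.eventually_const_lt h1).and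
    (eventually_mem_nhdsWithin (a := c₀) (s := Ioi c₀))).exists
  refine ⟨c, hlt, ?_⟩
  filter_upwards [eventually_lt_of_lt_liminf hc, hT] with x hx hx0
  exact ((lt_div_iff₀ hx0).1 (by exact_mod_cast hx)).le

/-! ### Extended regular variation makes `T_c` continuous in `c` -/

lemma tail_pow_mul_le {F : Measure ℝ} {c r x₀ : ℝ} (hc : 1 < c) (hx₀ : 0 < x₀) (hr : 0 ≤ r)
    (h : ∀ x, x₀ ≤ x → tail F (c * x) ≤ r * tail F x) (n : ℕ) {x : ℝ} (hx : x₀ ≤ x) :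
    tail F (c ^ n * x) ≤ r ^ n * tail F x := by
  induction n with
  | zero => simp
  | succ n ih =>
    calc tail F (c ^ (n + 1) * x) = tail F (c * (c ^ n * x)) := by rw [pow_succ', mul_assoc]
      _ ≤ r * tail F (c ^ n * x) := h _ (le_mul_pow hc hx₀ hx n)
      _ ≤ r * (r ^ n * tail F x) := by gcongr
      _ = _ := by ring

lemma ExtendedRegularlyVarying.exists_geometric {F : Measure ℝ}
    (hF : ExtendedRegularlyVarying F) (hpos : ∀ x, 0 < tail F x) {c : ℝ} (hc : 1 < c) :
    ∃ r x₀ : ℝ, 0 < r ∧ r < 1 ∧ 0 < x₀ ∧ ∀ x, x₀ ≤ x → tail F (c * x) ≤ r * tail F x := by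
  obtain ⟨αp, αm, hp, hm, h⟩ := hF
  have h1 : c ^ (-αp) < 1 := Real.rpow_lt_one_of_one_lt_of_neg hc (by linarith)
  obtain ⟨r, hr1, hr2⟩ := exists_between h1
  have hr : 0 < r := (Real.rpow_pos_of_pos (by linarith) _).trans hr1
  have h2 := (h c hc.le).2.trans_lt (EReal.coe_lt_coe_iff.2 hr1)
  obtain ⟨x₁, hx₁⟩ := eventually_atTop.1 (eventually_lt_of_limsup_lt h2)
  refine ⟨r, max x₁ 1, hr, hr2, by positivity, fun x hx => ?_⟩
  exact ((div_lt_iff₀ (hpos x)).1 (by exact_mod_cast hx₁ x ((le_max_left _ _).trans hx))).le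

/-- The upper index gives geometric decay, so terms beyond a fixed `N` contribute at most `ε/2`. In
the first `N` terms the arguments change by a factor of at most `ρ ^ N`, and the lower index bounds
the effect by a factor close to 1. Since `c'` bounds `c` from below, `N` and `ρ` do not depend on
`c`. -/
lemma ExtendedRegularlyVarying.tailSeries_le {F : Measure ℝ} [IsFiniteMeasure F]
    (hF : ExtendedRegularlyVarying F) (hpos : ∀ x, 0 < tail F x)
    (hsum : ∀ c, 1 < c → ∀ x, 0 < x → Summable fun n : ℕ => tail F (c ^ n * x))
    {c' ε : ℝ} (hc' : 1 < c') (hε : 0 < ε) :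
    ∃ ρ : ℝ, 1 < ρ ∧ ∀ c d, c' ≤ c → c ≤ d → d ≤ ρ * c →
      ∀ᶠ x in atTop, tailSeries F c x ≤ (1 + ε) * tailSeries F d x := by
  obtain ⟨r, x₀, hr0, hr1, hx₀, hr⟩ := hF.exists_geometric hpos hc'
  have h1r : 0 < 1 - r := by linarith
  obtain ⟨N, hN⟩ := exists_pow_lt_of_lt_one (show 0 < ε / 2 * (1 - r) by positivity) hr1
  obtain ⟨αp, αm, hp, hm, h⟩ := hF
  have hcont : Tendsto (fun ρ : ℝ => (ρ ^ N) ^ (-αm)) (𝓝[>] 1) (𝓝 1) := by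
    have : ContinuousAt (fun ρ : ℝ => (ρ ^ N) ^ (-αm)) 1 :=
      (continuousAt_id.pow N).rpow_const (Or.inl (by simp))
    simpa [ContinuousAt] using this.tendsto.mono_left nhdsWithin_le_nhds
  have hlt : (1 + ε / 2)⁻¹ < 1 := inv_lt_one_of_one_lt₀ (by linarith)
  obtain ⟨ρ, hρ, hρ1⟩ := ((hcont.eventually_const_lt hlt).and
    (eventually_mem_nhdsWithin (a := (1:ℝ)) (s := Ioi 1))).exists
  replace hρ1 : 1 < ρ := hρ1
  refine ⟨ρ, hρ1, fun c d hc hcd hd => ?_⟩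
  have hc1 : 1 < c := hc'.trans_le hc
  have h2 := (EReal.coe_lt_coe_iff.2 hρ).trans_le (h (ρ ^ N) (one_le_pow₀ hρ1.le)).1
  obtain ⟨z₀, hz₀⟩ := eventually_atTop.1 (eventually_lt_of_lt_liminf h2)
  filter_upwards [eventually_ge_atTop (max x₀ z₀)] with x hx
  have hxx₀ : x₀ ≤ x := (le_max_left _ _).trans hx
  have hxp : 0 < x := hx₀.trans_le hxx₀
  have hz₀x : z₀ ≤ x := (le_max_right _ _).trans hx
  have hhead : ∑ n ∈ Finset.range N, tail F (c ^ n * x) ≤ (1 + ε / 2) * tailSeries F d x := by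
    calc _ ≤ ∑ n ∈ Finset.range N, (1 + ε / 2) * tail F (d ^ n * x) := by
          refine Finset.sum_le_sum fun n hn => ?_
          have hz : z₀ ≤ c ^ n * x :=
            hz₀x.trans (le_mul_of_one_le_left hxp.le (one_le_pow₀ hc1.le))
          have h3 : (1 + ε / 2)⁻¹ < tail F (ρ ^ N * (c ^ n * x)) / tail F (c ^ n * x) := by
            exact_mod_cast hz₀ _ hz
          rw [lt_div_iff₀ (hpos _), inv_mul_lt_iff₀ (by positivity)] at h3
          refine h3.le.trans ?_
          gcongr
          refine tail_antitone F ?_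
          have hd0 : 0 ≤ d := by linarith
          calc d ^ n * x ≤ (ρ * c) ^ n * x := by gcongr
            _ = ρ ^ n * (c ^ n * x) := by rw [mul_pow, mul_assoc]
            _ ≤ _ := by
              gcongr
              · exact hρ1.le
              · exact (Finset.mem_range.1 hn).le
      _ = (1 + ε / 2) * ∑ n ∈ Finset.range N, tail F (d ^ n * x) := (Finset.mul_sum _ _ _).symm
      _ ≤ _ := by
          gcongr
          exact (hsum d (hc1.trans_le hcd) x hxp).sum_le_tsum _ fun _ _ => tail_nonneg _ _
  have hs := hsum c hc1 x hxp
  have hgeom := summable_geometric_of_lt_one hr0.le hr1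
  have htail : ∑' n : ℕ, tail F (c ^ (n + N) * x) ≤ ε / 2 * tailSeries F d x := by
    calc _ ≤ ∑' n : ℕ, r ^ N * tail F x * r ^ n := by
          refine ((summable_nat_add_iff N).2 hs).tsum_le_tsum (fun n => ?_) (hgeom.mul_left _)
          calc tail F (c ^ (n + N) * x) ≤ tail F (c' ^ (n + N) * x) :=
                tail_antitone F (by gcongr)
            _ ≤ r ^ (n + N) * tail F x := tail_pow_mul_le hc' hx₀ hr0.le hr _ hxx₀
            _ = _ := by ring
      _ = r ^ N * (1 - r)⁻¹ * tail F x := by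
          rw [tsum_mul_left, tsum_geometric_of_lt_one hr0.le hr1]; ring
      _ ≤ ε / 2 * tail F x := by
          have := hpos x
          gcongr
          rw [← div_eq_mul_inv, div_le_iff₀ h1r]
          exact hN.le
      _ ≤ _ := by
          gcongr
          exact tail_le_tailSeries (hsum d (hc1.trans_le hcd) x hxp)
  rw [tailSeries, ← hs.sum_add_tsum_nat_add N]
  linarith

lemma ExtendedRegularlyVarying.exists_lt {F : Measure ℝ} [IsFiniteMeasure F]
    (hF : ExtendedRegularlyVarying F) (hpos : ∀ x, 0 < tail F x)
    (hsum : ∀ c, 1 < c → ∀ x, 0 < x → Summable fun n : ℕ => tail F (c ^ n * x))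
    {c₀ ε : ℝ} (hc₀ : 1 < c₀) (hε : 0 < ε) :
    ∃ c, 1 < c ∧ c < c₀ ∧ ∀ᶠ x in atTop, tailSeries F c x ≤ (1 + ε) * tailSeries F c₀ x := by
  obtain ⟨c', hc', hc'₀⟩ := exists_between hc₀
  obtain ⟨ρ, hρ, h⟩ := hF.tailSeries_le hpos hsum hc' hε
  have h1 : max c' (c₀ / ρ) < c₀ := max_lt hc'₀ (div_lt_self (by linarith) hρ)
  refine ⟨max c' (c₀ / ρ), hc'.trans_le (le_max_left _ _), h1, h _ _ (le_max_left _ _) h1.le ?_⟩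
  rw [← div_le_iff₀' (by linarith)]
  exact le_max_right _ _

lemma ExtendedRegularlyVarying.exists_gt {F : Measure ℝ} [IsFiniteMeasure F]
    (hF : ExtendedRegularlyVarying F) (hpos : ∀ x, 0 < tail F x)
    (hsum : ∀ c, 1 < c → ∀ x, 0 < x → Summable fun n : ℕ => tail F (c ^ n * x))
    {c₀ ε : ℝ} (hc₀ : 1 < c₀) (hε : 0 < ε) (hε1 : ε < 1) :
    ∃ c, c₀ < c ∧ ∀ᶠ x in atTop, (1 - ε) * tailSeries F c₀ x ≤ tailSeries F c x := by
  obtain ⟨ρ, hρ, h⟩ := hF.tailSeries_le hpos hsum hc₀ hε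
  refine ⟨ρ * c₀, by nlinarith, ?_⟩
  filter_upwards [h c₀ (ρ * c₀) le_rfl (by nlinarith) le_rfl] with x hx
  have h1 : 0 ≤ tailSeries F (ρ * c₀) x := tailSeries_nonneg _ _ _
  calc _ ≤ (1 - ε) * ((1 + ε) * tailSeries F (ρ * c₀) x) := by
        have : 0 ≤ 1 - ε := by linarith
        gcongr
    _ ≤ _ := by nlinarith [mul_nonneg (sq_nonneg ε) h1]

/-! ### Regular variation -/

lemma RegularlyVarying.tendsto_ratio {F : Measure ℝ} {α : ℝ} (hF : RegularlyVarying F α)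
    (hpos : ∀ x, 0 < tail F x) {y : ℝ} (hy : 1 ≤ y) :
    Tendsto (fun x => tail F (y * x) / tail F x) atTop (𝓝 (y ^ (-α))) := by
  -- `SlowlyVarying` speaks only of factors greater than 1.
  rcases hy.eq_or_lt with rfl | hy
  · simp [(hpos _).ne']
  · obtain ⟨L, hL, hFL⟩ := hF
    have h : Tendsto (fun x => y ^ (-α) * (L (y * x) / L x)) atTop (𝓝 (y ^ (-α) * 1)) :=
      (hL y hy).const_mul _
    rw [mul_one] at h
    refine h.congr' ?_
    filter_upwards [eventually_gt_atTop 0] with x hx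
    have hx' : x ^ (-α) ≠ 0 := (Real.rpow_pos_of_pos hx _).ne'
    rw [hFL x hx, hFL (y * x) (by positivity), Real.mul_rpow (by linarith) hx.le,
      mul_comm (y ^ (-α)) (x ^ (-α)), mul_assoc, mul_div_mul_left _ _ hx', mul_div_assoc]

lemma RegularlyVarying.extendedRegularlyVarying {F : Measure ℝ} {α : ℝ}
    (hF : RegularlyVarying F α) (hα : 0 < α) (hpos : ∀ x, 0 < tail F x) :
    ExtendedRegularlyVarying F := by
  refine ⟨α, α, hα, hα, fun y hy => ?_⟩
  have h : Tendsto (fun x => ((tail F (y * x) / tail F x : ℝ) : EReal)) atTop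
      (𝓝 ((y ^ (-α) : ℝ) : EReal)) :=
    (continuous_coe_real_ereal.tendsto _).comp (hF.tendsto_ratio hpos hy)
  exact ⟨h.liminf_eq.ge, h.limsup_eq.le⟩

/-- Each term of the quotient tends to `(c ^ (-α)) ^ n`, and the geometric decay of extended regular
variation dominates the series. -/
lemma RegularlyVarying.tendsto_tailSeries_div {F : Measure ℝ} {α : ℝ}
    (hF : RegularlyVarying F α) (hα : 0 < α) (hpos : ∀ x, 0 < tail F x) {c : ℝ} (hc : 1 < c) :
    Tendsto (fun x => tailSeries F c x / tail F x) atTop (𝓝 (1 - c ^ (-α))⁻¹) := by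
  obtain ⟨r, x₀, hr0, hr1, hx₀, hr⟩ :=
    (hF.extendedRegularlyVarying hα hpos).exists_geometric hpos hc
  have hlt : c ^ (-α) < 1 := Real.rpow_lt_one_of_one_lt_of_neg hc (by linarith)
  rw [← tsum_geometric_of_lt_one (by positivity) hlt]
  have h : Tendsto (fun x => ∑' n : ℕ, tail F (c ^ n * x) / tail F x) atTop
      (𝓝 (∑' n : ℕ, (c ^ (-α)) ^ n)) := by
    refine tendsto_tsum_of_dominated_convergence (summable_geometric_of_lt_one hr0.le hr1)
      (fun n => ?_) ?_
    · have h1 := hF.tendsto_ratio hpos (one_le_pow₀ hc.le : 1 ≤ c ^ n)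
      rwa [← Real.rpow_natCast c, ← Real.rpow_mul (by linarith), mul_comm,
        Real.rpow_mul (by linarith), Real.rpow_natCast, Real.rpow_natCast] at h1
    · filter_upwards [eventually_ge_atTop x₀] with x hx n
      rw [Real.norm_of_nonneg (div_nonneg (tail_nonneg _ _) (tail_nonneg _ _)),
        div_le_iff₀ (hpos x)]
      exact tail_pow_mul_le hc hx₀ hr0.le hr n hx
  refine h.congr fun x => ?_
  rw [tsum_div_const, tailSeries]

/-- The partial sums `B_0 + ... + B_{n-1}`. -/
def partialSum {Ω : Type*} (B : ℕ → Ω → ℕ) (n : ℕ) (ω : Ω) : ℕ := ∑ i ∈ Finset.range n, B i ω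

lemma measurable_partialSum {Ω : Type*} [MeasurableSpace Ω] {B : ℕ → Ω → ℕ}
    (hB : ∀ i, Measurable (B i)) (n : ℕ) : Measurable (partialSum B n) := by
  unfold partialSum
  fun_prop

/-! ### Conditioning on the value of `X` -/

section Mixture

variable {Ω : Type*} [MeasurableSpace Ω] {P : Measure Ω}
  {A : Ω → ℕ} {B : ℕ → Ω → ℕ} {X : Ω → ℕ}

lemma IsFixedPointSolution.tailOf_eq (hX : IsFixedPointSolution P A B X) (x : ℝ) :
    tailOf P X x = P.real {ω | x < (A ω : ℝ) + (partialSum B (X ω) ω : ℝ)} := by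
  have h := hX.fixedPoint.measure_mem_eq (s := {k : ℕ | x < (k : ℝ)})
    (measurableSet_lt measurable_const (by fun_prop))
  rw [tailOf, measureReal_def, measureReal_def]
  refine congrArg ENNReal.toReal (h.trans (congrArg P ?_))
  ext ω
  simp [partialSum]

lemma IsFixedPointSolution.tailOf_B (hX : IsFixedPointSolution P A B X) (i : ℕ) (x : ℝ) :
    tailOf P (B i) x = tailOf P (B 0) x := by
  have h := (hX.identDistrib_B i).measure_mem_eq (s := {k : ℕ | x < (k : ℝ)})
    (measurableSet_lt measurable_const (by fun_prop))
  exact congrArg ENNReal.toReal h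

variable [IsProbabilityMeasure P]

/-- The law of total probability: `X` is independent of the whole vector `(A, B)`, so on `X = n` the
event `D n` keeps its unconditional probability. -/
lemma IsFixedPointSolution.hasSum_mixture (hX : IsFixedPointSolution P A B X)
    {D : ℕ → Set (ℕ × (ℕ → ℕ))} (hD : ∀ n, MeasurableSet (D n)) :
    HasSum (fun n => P.real {ω | X ω = n} * P.real {ω | (A ω, fun i => B i ω) ∈ D n})
      (P.real {ω | (A ω, fun i => B i ω) ∈ D (X ω)}) := by
  set Y : Ω → ℕ × (ℕ → ℕ) := fun ω => (A ω, fun i => B i ω) with hY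
  have hYm : Measurable Y :=
    hX.measurable_A.prodMk (measurable_pi_lambda _ fun i => hX.measurable_B i)
  have hset : {ω | Y ω ∈ D (X ω)} = ⋃ n, X ⁻¹' {n} ∩ Y ⁻¹' D n := by
    ext ω; simp
  have hsum : P {ω | Y ω ∈ D (X ω)} = ∑' n, P {ω | X ω = n} * P {ω | Y ω ∈ D n} := by
    rw [hset, measure_iUnion]
    · refine tsum_congr fun n => ?_
      exact hX.indep_X.measure_inter_preimage_eq_mul _ _ (measurableSet_singleton n) (hD n)
    · intro m n hmn
      refine Set.disjoint_left.2 fun ω h1 h2 => hmn ?_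
      exact h1.1.symm.trans h2.1
    · exact fun n => (hX.measurable_X (measurableSet_singleton n)).inter (hYm (hD n))
  have hne : ∑' n, P {ω | X ω = n} * P {ω | Y ω ∈ D n} ≠ ⊤ := hsum ▸ measure_ne_top _ _
  have h := (ENNReal.summable_toReal hne).hasSum
  rw [← ENNReal.tsum_toReal_eq fun n => ENNReal.ne_top_of_tsum_ne_top hne n, ← hsum] at h
  simp only [ENNReal.toReal_mul] at h
  exact h

lemma IsFixedPointSolution.hasSum_prob (hX : IsFixedPointSolution P A B X) (p : ℕ → Prop)
    [DecidablePred p] :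
    HasSum (fun n => P.real {ω | X ω = n} * (if p n then 1 else 0)) (P.real {ω | p (X ω)}) := by
  have h := hX.hasSum_mixture (D := fun n => {_q | p n}) fun n => MeasurableSet.const _
  convert h using 2 with n
  · by_cases hn : p n <;> simp [hn]
  · simp

lemma IsFixedPointSolution.hasSum_randomSum (hX : IsFixedPointSolution P A B X) (p : ℕ → Prop)
    [DecidablePred p] (x : ℝ) :
    HasSum (fun n => P.real {ω | X ω = n} * (if p n then tailOf P (partialSum B n) x else 0))
      (P.real {ω | p (X ω) ∧ x < (partialSum B (X ω) ω : ℝ)}) := by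
  have h := hX.hasSum_mixture
    (D := fun n => {q | p n ∧ x < ((∑ i ∈ Finset.range n, q.2 i : ℕ) : ℝ)}) fun n => by
      have h1 : MeasurableSet {q : ℕ × (ℕ → ℕ) | x < ((∑ i ∈ Finset.range n, q.2 i : ℕ) : ℝ)} :=
        measurableSet_lt measurable_const (by fun_prop)
      exact (MeasurableSet.const (p n)).inter h1
  convert h using 2 with n
  · by_cases hn : p n <;> simp [hn, tailOf, partialSum]
  · simp [partialSum]

/-- The independence of `A` and the random sum holds for each fixed number of summands by
`indep_A_B`, and mixing over `X` preserves the product because the factor of `A` does not depend on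
`n`. -/
lemma IsFixedPointSolution.prob_and (hX : IsFixedPointSolution P A B X) (u x : ℝ) :
    P.real {ω | u < (A ω : ℝ) ∧ x < (partialSum B (X ω) ω : ℝ)} =
      tailOf P A u * P.real {ω | x < (partialSum B (X ω) ω : ℝ)} := by
  have h := hX.hasSum_mixture
    (D := fun n => {q | u < (q.1 : ℝ) ∧ x < ((∑ i ∈ Finset.range n, q.2 i : ℕ) : ℝ)}) fun n => by
      have h1 : MeasurableSet {q : ℕ × (ℕ → ℕ) | x < ((∑ i ∈ Finset.range n, q.2 i : ℕ) : ℝ)} :=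
        measurableSet_lt measurable_const (by fun_prop)
      have h2 : MeasurableSet {q : ℕ × (ℕ → ℕ) | u < (q.1 : ℝ)} :=
        measurableSet_lt measurable_const (by fun_prop)
      exact h2.inter h1
  have h2 := (hX.hasSum_randomSum (fun _ => True) x).mul_left (tailOf P A u)
  simp only [true_and, if_true] at h2
  have heq : (fun n => P.real {ω | X ω = n} * P.real {ω | (A ω, fun i => B i ω) ∈
      {q : ℕ × (ℕ → ℕ) | u < (q.1 : ℝ) ∧ x < ((∑ i ∈ Finset.range n, q.2 i : ℕ) : ℝ)}}) =
      fun n => tailOf P A u * (P.real {ω | X ω = n} * tailOf P (partialSum B n) x) := by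
    funext n
    have h3 : P.real {ω | u < (A ω : ℝ) ∧ x < ((∑ i ∈ Finset.range n, B i ω : ℕ) : ℝ)} =
        tailOf P A u * tailOf P (partialSum B n) x := by
      have := hX.indep_A_B.measure_inter_preimage_eq_mul {a : ℕ | u < (a : ℝ)}
        {q : ℕ → ℕ | x < ((∑ i ∈ Finset.range n, q i : ℕ) : ℝ)}
        (measurableSet_lt measurable_const (by fun_prop))
        (measurableSet_lt measurable_const (by fun_prop))
      rw [tailOf, tailOf, measureReal_def, measureReal_def, measureReal_def, ← ENNReal.toReal_mul]
      exact congrArg ENNReal.toReal this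
    calc _ = P.real {ω | X ω = n} * (tailOf P A u * tailOf P (partialSum B n) x) :=
          congrArg _ h3
      _ = _ := by ring
  rw [heq] at h
  exact h.unique h2

end Mixture

/-! ### The bound `t P(B > t) ≤ C tail G t` and truncated second moments -/

section Moments

variable {Ω : Type*} [MeasurableSpace Ω] {P : Measure Ω} [IsProbabilityMeasure P]

lemma exists_mul_tailOf_le_of_eventually {G : Measure ℝ} [IsFiniteMeasure G]
    (hpos : ∀ x, 0 < tail G x) {Z : Ω → ℕ} {C : ℝ}
    (h : ∀ᶠ t in atTop, t * tailOf P Z t ≤ C * tail G t) :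
    ∃ C' : ℝ, 0 < C' ∧ ∀ t, 0 < t → t * tailOf P Z t ≤ C' * tail G t := by
  obtain ⟨t₁, ht₁⟩ := eventually_atTop.1 h
  set t₀ := max t₁ 1 with ht₀
  have h0 : 0 < t₀ := by positivity
  have hp := hpos t₀
  refine ⟨max C (t₀ / tail G t₀), lt_max_of_lt_right (by positivity), fun t ht => ?_⟩
  have hpt := hpos t
  rcases le_total t₀ t with h1 | h1
  · refine (ht₁ t ((le_max_left _ _).trans h1)).trans ?_
    gcongr
    exact le_max_left _ _
  · calc t * tailOf P Z t ≤ t₀ * 1 := by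
          gcongr
          · exact tailOf_nonneg P Z t
          · exact tailOf_le_one P Z t
      _ = t₀ / tail G t₀ * tail G t₀ := by field_simp
      _ ≤ t₀ / tail G t₀ * tail G t := by
          gcongr
          exact tail_antitone G h1
      _ ≤ _ := by
          gcongr
          exact le_max_right _ _

/-- Condition (I): Chebyshev gives `t P(Z > t) ≤ V / t`, and `1 / t < tail G t / a` for large `t`.
-/
lemma exists_mul_tailOf_le_of_memLp {G : Measure ℝ} [IsFiniteMeasure G]
    (hpos : ∀ x, 0 < tail G x) {Z : Ω → ℕ} (hZ : MemLp (fun ω => (Z ω : ℝ)) 2 P)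
    (h : 0 < liminf (fun x : ℝ => ((x * tail G x : ℝ) : EReal)) atTop) :
    ∃ C : ℝ, 0 < C ∧ ∀ t, 0 < t → t * tailOf P Z t ≤ C * tail G t := by
  obtain ⟨a, ha0, ha⟩ := EReal.lt_iff_exists_real_btwn.1 h
  have ha0' : 0 < a := by exact_mod_cast ha0
  set V := ∫ ω, (Z ω : ℝ) ^ 2 ∂P with hV
  have hV0 : 0 ≤ V := integral_nonneg fun ω => by positivity
  refine exists_mul_tailOf_le_of_eventually hpos (C := V / a) ?_
  filter_upwards [eventually_lt_of_lt_liminf ha, eventually_gt_atTop 0] with t hta ht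
  have hta' : a < t * tail G t := by exact_mod_cast hta
  have h1 : t ^ 2 * tailOf P Z t ≤ V := by
    refine le_trans ?_ (mul_meas_ge_le_integral_of_nonneg (μ := P)
      (f := fun ω => (Z ω : ℝ) ^ 2) (Eventually.of_forall fun ω => by positivity)
      hZ.integrable_sq (t ^ 2))
    gcongr
    refine measureReal_mono fun ω hω => ?_
    exact pow_le_pow_left₀ ht.le (le_of_lt hω) 2
  rw [div_mul_eq_mul_div, le_div_iff₀ ha0']
  have h2 : t * tailOf P Z t * a ≤ t * tailOf P Z t * (t * tail G t) := by
    have := tailOf_nonneg P Z t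
    gcongr
  have h3 : t ^ 2 * tailOf P Z t * tail G t ≤ V * tail G t := by
    have := hpos t
    gcongr
  nlinarith

lemma truncIntegratedTail_tendsto_zero {F : Measure ℝ}
    (hF : ∫⁻ u in Ioi 0, F (Ioi u) ≠ ⊤) : Tendsto (truncIntegratedTail F) atTop (𝓝 0) := by
  set ν := volume.withDensity fun u => F (Ioi u) with hν
  have happ : ∀ x, ν (Ioi x) = ∫⁻ u in Ioi x, F (Ioi u) := fun x =>
    withDensity_apply _ measurableSet_Ioi
  have h1 : Tendsto (fun x : ℝ => ν (Ioi x)) atTop (𝓝 (ν (⋂ x : ℝ, Ioi x))) :=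
    tendsto_measure_iInter_atTop (fun x => measurableSet_Ioi.nullMeasurableSet)
      (fun _ _ h => Ioi_subset_Ioi h) ⟨0, by rwa [happ]⟩
  have h2 : (⋂ x : ℝ, Ioi x) = ∅ := by
    ext z
    simp only [mem_iInter, mem_Ioi, mem_empty_iff_false, iff_false, not_forall, not_lt]
    exact ⟨z, le_rfl⟩
  rw [h2, measure_empty] at h1
  have h3 : Tendsto (fun x => min 1 (ν (Ioi x))) atTop (𝓝 (min 1 0)) := tendsto_const_nhds.min h1
  rw [min_eq_right (zero_le)] at h3
  have h4 := (ENNReal.tendsto_toReal ENNReal.zero_ne_top).comp h3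
  refine h4.congr fun x => ?_
  simp [truncIntegratedTail, happ]

lemma tail_integratedTailDistribution {F : Measure ℝ}
    (hF : ∫⁻ u in Ioi 0, F (Ioi u) ≠ ⊤) (x : ℝ) :
    tail (integratedTailDistribution F) x = truncIntegratedTail F x := by
  have h := (truncIntegratedTail_tendsto_zero hF).const_sub 1
  rw [tail, measureReal_def, integratedTailDistribution, StieltjesFunction.measure_Ioi _ h,
    ENNReal.toReal_ofReal]
  · simp
  · simp [truncIntegratedTail]

/-- Condition (II): `t P(Z > 2t)` is at most the integral of the tail over `(t, 2t]`, hence at most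
the integrated tail at `t`. Dominant variation absorbs the factor 2, and a mean below 1 keeps the
truncation at 1 inactive on `[0, ∞)`. -/
lemma exists_mul_tailOf_le_of_integratedTail {G : Measure ℝ} [IsProbabilityMeasure G]
    (hG : DominantlyVarying G) {Z : Ω → ℕ} (hZ : Measurable Z) {b : ℝ}
    (hb : ∫⁻ ω, (Z ω : ENNReal) ∂P = ENNReal.ofReal b) (hb1 : b < 1)
    (h : limsup (fun x : ℝ => ((tail (integratedTailDistribution (P.map fun ω => (Z ω : ℝ))) x /
      tail G x : ℝ) : EReal)) atTop < ⊤) :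
    ∃ C : ℝ, 0 < C ∧ ∀ t, 0 < t → t * tailOf P Z t ≤ C * tail G t := by
  set F := P.map fun ω => (Z ω : ℝ) with hF
  have hZr : Measurable fun ω => (Z ω : ℝ) := by fun_prop
  have hFapp : ∀ u : ℝ, F (Ioi u) = P {ω | u < (Z ω : ℝ)} := fun u =>
    Measure.map_apply hZr measurableSet_Ioi
  have hint : ∫⁻ u in Ioi 0, F (Ioi u) = ENNReal.ofReal b := by
    rw [← hb]
    simp_rw [hFapp]
    rw [← lintegral_eq_lintegral_meas_lt P (Eventually.of_forall fun ω => by positivity)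
      hZr.aemeasurable]
    simp
  have hfin : ∫⁻ u in Ioi 0, F (Ioi u) ≠ ⊤ := hint ▸ ENNReal.ofReal_ne_top
  have hslice : ∀ t : ℝ, 0 ≤ t → ENNReal.ofReal t * F (Ioi (2 * t)) ≤ ∫⁻ u in Ioi t, F (Ioi u) := by
    intro t ht
    calc ENNReal.ofReal t * F (Ioi (2 * t)) = ∫⁻ _ in Ioc t (2 * t), F (Ioi (2 * t)) := by
          rw [setLIntegral_const, Real.volume_Ioc, mul_comm]; congr 2; ring
      _ ≤ ∫⁻ u in Ioc t (2 * t), F (Ioi u) :=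
          setLIntegral_mono' measurableSet_Ioc fun u hu => measure_mono (Ioi_subset_Ioi hu.2)
      _ ≤ _ := lintegral_mono_set Ioc_subset_Ioi_self
  obtain ⟨C, hC, -⟩ := EReal.lt_iff_exists_real_btwn.1 h
  have hpos := hG.tail_pos
  obtain ⟨C₂, hC₂, hG₂⟩ := hG.tail_mul_le (show (0:ℝ) < 1 / 2 by norm_num)
  refine exists_mul_tailOf_le_of_eventually hpos (C := 2 * (max C 0 * C₂)) ?_
  have ht2 : Tendsto (fun t : ℝ => 1 / 2 * t) atTop atTop :=
    tendsto_id.const_mul_atTop (by norm_num)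
  filter_upwards [ht2.eventually (eventually_lt_of_limsup_lt hC), eventually_gt_atTop 0]
    with t htC ht
  have h1 : tail (integratedTailDistribution F) (1 / 2 * t) ≤ C * tail G (1 / 2 * t) :=
    ((div_lt_iff₀ (hpos _)).1 (by exact_mod_cast htC)).le
  rw [tail_integratedTailDistribution hfin] at h1
  have h2 : 1 / 2 * t * tailOf P Z t ≤ truncIntegratedTail F (1 / 2 * t) := by
    have h3 := hslice (1 / 2 * t) (by positivity)
    rw [show 2 * (1 / 2 * t) = t by ring] at h3
    have h4 : ∫⁻ u in Ioi (1 / 2 * t), F (Ioi u) ≤ 1 := by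
      refine (lintegral_mono_set (Ioi_subset_Ioi (by positivity))).trans ?_
      rw [hint]
      exact ENNReal.ofReal_le_one.2 hb1.le
    rw [truncIntegratedTail, min_eq_right h4]
    have h5 := ENNReal.toReal_mono (ne_top_of_le_ne_top ENNReal.one_ne_top h4) h3
    rwa [ENNReal.toReal_mul, ENNReal.toReal_ofReal (by positivity), hFapp] at h5
  calc t * tailOf P Z t = 2 * (1 / 2 * t * tailOf P Z t) := by ring
    _ ≤ 2 * (C * tail G (1 / 2 * t)) := by linarith
    _ ≤ 2 * (max C 0 * (C₂ * tail G t)) := by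
        have := hpos (1 / 2 * t)
        gcongr
        · exact le_max_left _ _
        · exact hG₂ t ht
    _ = _ := by ring

lemma integral_min_sq_le {G : Measure ℝ} [IsProbabilityMeasure G] (hG : DominantlyVarying G)
    {Z : Ω → ℕ} (hZ : Measurable Z) {C : ℝ} (hC : 0 < C)
    (hZG : ∀ t, 0 < t → t * tailOf P Z t ≤ C * tail G t) :
    ∃ C₂ δ : ℝ, 0 < C₂ ∧ 0 < δ ∧ ∀ y, 0 < y →
      ∫ ω, min (Z ω : ℝ) y ^ 2 ∂P ≤ C₂ * y * tail G y ^ δ := by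
  obtain ⟨K, α, hK, hα, hpot⟩ := hG.potter
  have hpos := hG.tail_pos
  -- As tails are at most 1, `tail G t ≤ tail G t ^ δ`; the Potter bound to the power `δ` then grows
  -- only like `(y / t) ^ (1/2)`, which is integrable at 0 in `2 ∫ t P(Z > t) dt`.
  set δ := 1 / (2 * α) with hδ
  have hα0 : 0 < α := by linarith
  have hδ0 : 0 < δ := by positivity
  have hδ1 : δ ≤ 1 := by
    rw [hδ, div_le_one (by positivity)]; linarith
  refine ⟨4 * (C * K ^ δ), δ, by positivity, hδ0, fun y hy => ?_⟩
  set Q := C * K ^ δ * y ^ (1 / 2 : ℝ) * tail G y ^ δ with hQ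
  have hQ0 : 0 ≤ Q := by have := (hpos y).le; positivity
  have hpt : ∀ t, 0 < t → t ≤ y → t * tailOf P Z t ≤ Q * t ^ (-(1 / 2) : ℝ) := by
    intro t ht hty
    have h1 : tail G t ≤ K ^ δ * (y / t) ^ (1 / 2 : ℝ) * tail G y ^ δ := by
      calc tail G t = tail G t ^ (1 : ℝ) := (Real.rpow_one _).symm
        _ ≤ tail G t ^ δ :=
            Real.rpow_le_rpow_of_exponent_ge (hpos t) (tail_le_one G t) hδ1
        _ ≤ (K * (y / t) ^ α * tail G y) ^ δ :=
            Real.rpow_le_rpow (hpos t).le (hpot t y ht hty) hδ0.le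
        _ = _ := by
            rw [Real.mul_rpow (by positivity) (hpos y).le, Real.mul_rpow (by positivity)
              (by positivity), ← Real.rpow_mul (by positivity)]
            congr 3
            rw [hδ]; field_simp
    calc t * tailOf P Z t ≤ C * tail G t := hZG t ht
      _ ≤ C * (K ^ δ * (y / t) ^ (1 / 2 : ℝ) * tail G y ^ δ) := by gcongr
      _ = _ := by
          rw [hQ, Real.div_rpow hy.le ht.le, Real.rpow_neg ht.le]; ring
  have hm : Measurable fun ω => min (Z ω : ℝ) y := by fun_prop
  have hnn : ∀ ω, 0 ≤ min (Z ω : ℝ) y := fun ω => le_min (by positivity) hy.le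
  have hlay := lintegral_rpow_eq_lintegral_meas_lt_mul P
    (Eventually.of_forall hnn) hm.aemeasurable (p := 2) two_pos
  have hII : IntervalIntegrable (fun t : ℝ => Q * t ^ (-(1 / 2) : ℝ)) volume 0 y :=
    (intervalIntegral.intervalIntegrable_rpow' (by norm_num)).const_mul _
  have hbound : ∫⁻ t in Ioi 0, P {ω | t < min (Z ω : ℝ) y} * ENNReal.ofReal (t ^ (2 - 1 : ℝ)) ≤
      ENNReal.ofReal (2 * Q * y ^ (1 / 2 : ℝ)) := by
    calc _ ≤ ∫⁻ t in Ioi 0, (Ioc 0 y).indicator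
            (fun t => ENNReal.ofReal (Q * t ^ (-(1 / 2) : ℝ))) t := by
          refine setLIntegral_mono' measurableSet_Ioi fun t ht => ?_
          replace ht : 0 < t := ht
          by_cases hty : t ≤ y
          · rw [indicator_of_mem (show t ∈ Ioc 0 y from ⟨ht, hty⟩)]
            refine le_trans ?_ (ENNReal.ofReal_le_ofReal (hpt t ht hty))
            rw [ENNReal.ofReal_mul ht.le, mul_comm, show (2 - 1 : ℝ) = 1 by norm_num,
              Real.rpow_one, tailOf, ofReal_measureReal]
            gcongr
            exact min_le_left _ _
          · have : {ω | t < min (Z ω : ℝ) y} = ∅ := by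
              ext ω
              simp only [mem_ofPred_eq, mem_empty_iff_false, iff_false, not_lt]
              exact (min_le_right _ _).trans (not_le.1 hty).le
            rw [this, measure_empty, zero_mul]
            exact zero_le
      _ = ∫⁻ t in Ioc 0 y, ENNReal.ofReal (Q * t ^ (-(1 / 2) : ℝ)) := by
          rw [lintegral_indicator measurableSet_Ioc, Measure.restrict_restrict measurableSet_Ioc,
            inter_eq_left.2 Ioc_subset_Ioi_self]
      _ = ENNReal.ofReal (∫ t in (0:ℝ)..y, Q * t ^ (-(1 / 2) : ℝ)) := by
          rw [intervalIntegral.integral_of_le hy.le, ofReal_integral_eq_lintegral_ofReal]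
          · exact (intervalIntegrable_iff_integrableOn_Ioc_of_le hy.le).1 hII
          · filter_upwards [ae_restrict_mem measurableSet_Ioc] with t ht
            have := ht.1.le
            positivity
      _ = _ := by
          congr 1
          rw [intervalIntegral.integral_const_mul, integral_rpow (Or.inl (by norm_num)),
            show (-(1 / 2) + 1 : ℝ) = 1 / 2 by norm_num, Real.zero_rpow (by norm_num)]
          ring
  rw [integral_eq_lintegral_of_nonneg_ae (Eventually.of_forall fun ω => by positivity)
    (by fun_prop)]
  simp_rw [← Real.rpow_natCast, Nat.cast_ofNat]
  rw [hlay]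
  refine ENNReal.toReal_le_of_le_ofReal (by have := (hpos y).le; positivity) ?_
  calc _ ≤ ENNReal.ofReal 2 * ENNReal.ofReal (2 * Q * y ^ (1 / 2 : ℝ)) := by gcongr
    _ = ENNReal.ofReal (2 * (2 * Q * y ^ (1 / 2 : ℝ))) := (ENNReal.ofReal_mul (by norm_num)).symm
    _ = _ := by
        congr 1
        have : y ^ (1 / 2 : ℝ) * y ^ (1 / 2 : ℝ) = y := by
          rw [← Real.rpow_add hy]; norm_num
        rw [hQ]
        linear_combination (4 * C * K ^ δ * tail G y ^ δ) * this

end Moments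

lemma integral_cast_eq {Ω : Type*} [MeasurableSpace Ω] {P : Measure Ω} {Z : Ω → ℕ} (hZ : Measurable Z) {b : ℝ} (hb0 : 0 < b)
    (hb : ∫⁻ ω, (Z ω : ENNReal) ∂P = ENNReal.ofReal b) :
    Integrable (fun ω => (Z ω : ℝ)) P ∧ ∫ ω, (Z ω : ℝ) ∂P = b := by
  have h : ∫⁻ ω, ENNReal.ofReal (Z ω : ℝ) ∂P = ENNReal.ofReal b := by simpa using hb
  have hm : AEStronglyMeasurable (fun ω => (Z ω : ℝ)) P :=
    (show Measurable fun ω => (Z ω : ℝ) by fun_prop).aestronglyMeasurable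
  have hnn : 0 ≤ᵐ[P] fun ω => (Z ω : ℝ) := Eventually.of_forall fun ω => by positivity
  constructor
  · refine ⟨hm, ?_⟩
    rw [hasFiniteIntegral_iff_ofReal hnn, h]
    exact ENNReal.ofReal_lt_top
  · rw [integral_eq_lintegral_of_nonneg_ae hnn hm, h, ENNReal.toReal_ofReal hb0.le]

/-! ### A Chernoff bound for bounded summands -/

section Sums

variable {Ω : Type*} [MeasurableSpace Ω] {P : Measure Ω} [IsProbabilityMeasure P]

/-- For `v ≤ 1`, multiply `(1 - v) exp v ≤ 1` by `1 + v`; for `v ≥ 1` the last term alone suffices.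
-/
lemma exp_le_one_add_add_sq_mul_exp {v : ℝ} (hv : 0 ≤ v) :
    Real.exp v ≤ 1 + v + v ^ 2 * Real.exp v := by
  rcases le_total 1 v with h | h
  · have h1 : 1 ≤ v ^ 2 := one_le_pow₀ h
    nlinarith [Real.exp_pos v]
  · have h1 : 1 - v ≤ Real.exp (-v) := by linarith [Real.add_one_le_exp (-v)]
    have h2 : Real.exp (-v) * Real.exp v = 1 := by rw [← Real.exp_add]; simp
    have h3 : (1 - v) * Real.exp v ≤ 1 := by
      calc (1 - v) * Real.exp v ≤ Real.exp (-v) * Real.exp v := by gcongr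
        _ = 1 := h2
    nlinarith [mul_le_mul_of_nonneg_left h3 (by linarith : 0 ≤ 1 + v)]

lemma integrable_of_bounded_mem {Z : Ω → ℝ} (hZ : Measurable Z) {M : ℝ}
    (h : ∀ ω, |Z ω| ≤ M) : Integrable Z P :=
  Integrable.of_bound hZ.aestronglyMeasurable M (Eventually.of_forall h)

/-- An exponential bound for sums of i.i.d. random variables with values in `[0, y]`. -/
lemma prob_sum_ge_le {D : ℕ → Ω → ℝ} (hm : ∀ i, Measurable (D i)) (hind : iIndepFun D P)
    (hid : ∀ i, IdentDistrib (D i) (D 0) P P) {y b V s : ℝ} (hD0 : ∀ i ω, 0 ≤ D i ω)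
    (hDy : ∀ i ω, D i ω ≤ y) (hs : 0 ≤ s) (hb : ∫ ω, D 0 ω ∂P ≤ b)
    (hV : ∫ ω, D 0 ω ^ 2 ∂P ≤ V) (n : ℕ) (z : ℝ) :
    P.real {ω | z ≤ ∑ i ∈ Finset.range n, D i ω} ≤
      Real.exp (-s * z + n * (s * b + s ^ 2 * Real.exp (s * y) * V)) := by
  have hint : ∀ i, Integrable (D i) P := fun i =>
    integrable_of_bounded_mem (hm i) fun ω => by rw [abs_of_nonneg (hD0 i ω)]; exact hDy i ω
  have hint2 : Integrable (fun ω => D 0 ω ^ 2) P :=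
    integrable_of_bounded_mem ((hm 0).pow_const 2) (M := y ^ 2) fun ω => by
      rw [abs_of_nonneg (by positivity)]
      exact pow_le_pow_left₀ (hD0 0 ω) (hDy 0 ω) 2
  have hmgf : mgf (D 0) P s ≤ Real.exp (s * b + s ^ 2 * Real.exp (s * y) * V) := by
    calc mgf (D 0) P s ≤ ∫ ω, (1 + s * D 0 ω + s ^ 2 * Real.exp (s * y) * D 0 ω ^ 2) ∂P := by
          refine integral_mono_of_nonneg (Eventually.of_forall fun ω => (Real.exp_pos _).le)
            (((integrable_const 1).add ((hint 0).const_mul s)).add (hint2.const_mul _))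
            (Eventually.of_forall fun ω => ?_)
          have h0 := hD0 0 ω
          have h1 := hDy 0 ω
          refine (exp_le_one_add_add_sq_mul_exp (mul_nonneg hs h0)).trans ?_
          have : (s * D 0 ω) ^ 2 * Real.exp (s * D 0 ω) ≤ (s * D 0 ω) ^ 2 * Real.exp (s * y) := by
            gcongr
          change 1 + s * D 0 ω + _ ≤ 1 + s * D 0 ω + _
          linarith
      _ = 1 + s * (∫ ω, D 0 ω ∂P) + s ^ 2 * Real.exp (s * y) * (∫ ω, D 0 ω ^ 2 ∂P) := by
          have h1 : Integrable (fun ω => 1 + s * D 0 ω) P :=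
            (integrable_const 1).add ((hint 0).const_mul s)
          rw [integral_add h1 (hint2.const_mul _),
            integral_add (integrable_const 1) ((hint 0).const_mul s), integral_const_mul,
            integral_const_mul]
          simp
      _ ≤ 1 + s * b + s ^ 2 * Real.exp (s * y) * V := by gcongr
      _ ≤ _ := by
          have := Real.add_one_le_exp (s * b + s ^ 2 * Real.exp (s * y) * V)
          linarith
  have hsum : mgf (∑ i ∈ Finset.range n, D i) P s = mgf (D 0) P s ^ n := by
    rw [hind.mgf_sum hm, Finset.prod_congr rfl fun i _ => congrFun (mgf_congr_identDistrib (hid i)) s]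
    simp
  have hsm : Measurable (∑ i ∈ Finset.range n, D i) := by
    rw [show ∑ i ∈ Finset.range n, D i = fun ω => ∑ i ∈ Finset.range n, D i ω by
      funext ω; exact Finset.sum_apply _ _ _]
    exact Finset.measurable_sum (Finset.range n) fun i _ => hm i
  have hle : ∀ ω, (∑ i ∈ Finset.range n, D i) ω ≤ n * y := fun ω => by
    rw [Finset.sum_apply]
    exact (Finset.sum_le_sum fun i _ => hDy i ω).trans (by simp)
  have hexp : Integrable (fun ω => Real.exp (s * (∑ i ∈ Finset.range n, D i) ω)) P :=
    integrable_of_bounded_mem (hsm.const_mul s).exp (M := Real.exp (s * (n * y))) fun ω => by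
      rw [abs_of_pos (Real.exp_pos _)]
      have := hle ω
      gcongr
  have h := measure_ge_le_exp_mul_mgf (μ := P) z hs hexp
  simp only [Finset.sum_apply] at h
  refine h.trans ?_
  rw [hsum, Real.exp_add, Real.exp_nat_mul]
  gcongr
  exact mgf_nonneg

end Sums

/-! ### Deviations of partial and random sums -/

section Bounds

variable {Ω : Type*} [MeasurableSpace Ω] {P : Measure Ω} [IsProbabilityMeasure P]
  {A : Ω → ℕ} {B : ℕ → Ω → ℕ} {X : Ω → ℕ}

/-- Either some summand exceeds `y`, or truncation at `y` leaves the sum unchanged. -/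
lemma IsFixedPointSolution.tailOf_partialSum_le (hX : IsFixedPointSolution P A B X) (n : ℕ)
    (y z : ℝ) :
    tailOf P (partialSum B n) z ≤ n * tailOf P (B 0) y +
      P.real {ω | z ≤ ∑ i ∈ Finset.range n, min (B i ω : ℝ) y} := by
  calc tailOf P (partialSum B n) z
      ≤ P.real ((⋃ i ∈ Finset.range n, {ω | y < (B i ω : ℝ)}) ∪
          {ω | z ≤ ∑ i ∈ Finset.range n, min (B i ω : ℝ) y}) := by
        refine measureReal_mono fun ω hω => ?_
        by_cases h : ∃ i ∈ Finset.range n, y < (B i ω : ℝ)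
        · left
          obtain ⟨i, hi, hyi⟩ := h
          exact mem_biUnion hi hyi
        · right
          push Not at h
          have h1 : z < (partialSum B n ω : ℝ) := hω
          rw [partialSum, Nat.cast_sum] at h1
          change z ≤ ∑ i ∈ Finset.range n, min (B i ω : ℝ) y
          rw [Finset.sum_congr rfl fun i hi => min_eq_left (h i hi)]
          exact h1.le
    _ ≤ P.real (⋃ i ∈ Finset.range n, {ω | y < (B i ω : ℝ)}) + _ := measureReal_union_le _ _
    _ ≤ _ := by
        gcongr
        refine (measureReal_biUnion_finset_le _ _).trans ?_
        calc _ = ∑ _i ∈ Finset.range n, tailOf P (B 0) y :=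
              Finset.sum_congr rfl fun i _ => hX.tailOf_B i y
          _ ≤ _ := by simp

lemma IsFixedPointSolution.prob_truncated_sum_ge_le (hX : IsFixedPointSolution P A B X)
    {y b V s : ℝ} (hy : 0 < y) (hs : 0 ≤ s) (hb0 : 0 < b)
    (hb : ∫⁻ ω, (B 0 ω : ENNReal) ∂P = ENNReal.ofReal b)
    (hV : ∫ ω, min (B 0 ω : ℝ) y ^ 2 ∂P ≤ V) (n : ℕ) (z : ℝ) :
    P.real {ω | z ≤ ∑ i ∈ Finset.range n, min (B i ω : ℝ) y} ≤
      Real.exp (-s * z + n * (s * b + s ^ 2 * Real.exp (s * y) * V)) := by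
  have hφ : Measurable fun k : ℕ => min (k : ℝ) y := by fun_prop
  refine prob_sum_ge_le (D := fun i ω => min (B i ω : ℝ) y) (fun i => hφ.comp (hX.measurable_B i))
    (hX.iIndep_B.comp (fun _ k => min (k : ℝ) y) fun _ => hφ)
    (fun i => (hX.identDistrib_B i).comp hφ) (fun i ω => le_min (by positivity) hy.le)
    (fun i ω => min_le_right _ _) hs ?_ hV n z
  obtain ⟨hint, hval⟩ := integral_cast_eq (hX.measurable_B 0) hb0 hb
  rw [← hval]
  exact integral_mono_of_nonneg (Eventually.of_forall fun ω => le_min (by positivity) hy.le) hint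
    (Eventually.of_forall fun ω => min_le_left _ _)

/-- Uniformly over the number `n ≤ c x` of summands, the probability that the partial sum exceeds
`z x` is of the order of the tail of `G`, provided `c E(B) < z`. -/
lemma IsFixedPointSolution.exists_uniform_bound (hX : IsFixedPointSolution P A B X)
    {G : Measure ℝ} [IsProbabilityMeasure G] (hG : DominantlyVarying G) {b c z C : ℝ}
    (hb0 : 0 < b) (hb : ∫⁻ ω, (B 0 ω : ENNReal) ∂P = ENNReal.ofReal b) (hC : 0 < C)
    (hBG : ∀ t, 0 < t → t * tailOf P (B 0) t ≤ C * tail G t) (hc : 0 < c) (hcz : c * b < z) :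
    ∃ C' : ℝ, 0 < C' ∧ ∀ x, 0 < x → ∀ n : ℕ, (n : ℝ) ≤ c * x →
      tailOf P (partialSum B n) (z * x) ≤ C' * tail G x := by
  obtain ⟨C₂, δ, hC₂, hδ, hsq⟩ := integral_min_sq_le hG (hX.measurable_B 0) hC hBG
  have hpos := hG.tail_pos
  set θ := z - c * b with hθ
  have hθ0 : 0 < θ := by linarith
  -- Truncating at `y = x / M` with Chernoff parameter `v / y` makes the leading exponent `-θ M v`
  -- equal to `log g`, exactly the order of the tail of `G`.
  set M := 2 / (θ * δ) with hM
  have hM0 : 0 < M := by positivity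
  obtain ⟨C₃, hC₃, hG₃⟩ := hG.tail_mul_le (inv_pos.2 hM0)
  refine ⟨(c * M * C + Real.exp (2 * (c * M * C₂))) * C₃, by positivity, fun x hx n hn => ?_⟩
  set y := M⁻¹ * x with hy
  have hy0 : 0 < y := by positivity
  have hxy : x = M * y := by rw [hy]; field_simp
  set g := tail G y with hg
  have hg0 : 0 < g := hpos y
  -- Then `exp v = g ^ (-δ/2)`, so the factor `g ^ δ` of the truncated second moment beats it and
  -- leaves `v² exp (-v)`, which is bounded.
  set v := -(δ / 2) * Real.log g with hv
  have hv0 : 0 ≤ v := by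
    have := Real.log_nonpos hg0.le (tail_le_one G y)
    rw [hv]; nlinarith
  have hgδ : g ^ δ = Real.exp (-(2 * v)) := by
    rw [Real.rpow_def_of_pos hg0, hv]; congr 1; ring
  have hgexp : Real.exp (-(θ * M * v)) = g := by
    have : -(θ * M * v) = Real.log g := by rw [hM, hv]; field_simp
    rw [this, Real.exp_log hg0]
  have hchern := hX.prob_truncated_sum_ge_le hy0 (s := v / y) (by positivity) hb0 hb
    (hsq y hy0) n (z * x)
  have hexpo : -(v / y) * (z * x) + n * (v / y * b + (v / y) ^ 2 * Real.exp (v / y * y) *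
      (C₂ * y * g ^ δ)) ≤ -(θ * M * v) + 2 * (c * M * C₂) := by
    have h1 : v ^ 2 * Real.exp (-v) ≤ 2 := by
      have h2 := Real.quadratic_le_exp_of_nonneg hv0
      rw [Real.exp_neg, ← div_eq_mul_inv, div_le_iff₀ (Real.exp_pos v)]
      nlinarith
    have h3 : (v / y) ^ 2 * Real.exp (v / y * y) * (C₂ * y * g ^ δ) =
        C₂ / y * (v ^ 2 * Real.exp (-v)) := by
      rw [hgδ, div_mul_cancel₀ _ hy0.ne', show -v = v + -(2 * v) by ring, Real.exp_add]
      field_simp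
    rw [h3]
    have h4 : n * (v / y * b + C₂ / y * (v ^ 2 * Real.exp (-v))) ≤
        c * x * (v / y * b + C₂ / y * 2) := by gcongr
    refine (add_le_add_right h4 _).trans (le_of_eq ?_)
    rw [hxy, hθ]
    field_simp
    ring
  have hfirst : n * tailOf P (B 0) y ≤ c * M * C * g := by
    have := tailOf_nonneg P (B 0) y
    calc n * tailOf P (B 0) y ≤ c * x * tailOf P (B 0) y := by gcongr
      _ = c * M * (y * tailOf P (B 0) y) := by rw [hxy]; ring
      _ ≤ c * M * (C * g) := mul_le_mul_of_nonneg_left (hBG y hy0) (by positivity)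
      _ = _ := by ring
  calc tailOf P (partialSum B n) (z * x)
      ≤ n * tailOf P (B 0) y + P.real {ω | z * x ≤ ∑ i ∈ Finset.range n, min (B i ω : ℝ) y} :=
        hX.tailOf_partialSum_le n y (z * x)
    _ ≤ c * M * C * g + Real.exp (2 * (c * M * C₂)) * g := by
        refine add_le_add hfirst (hchern.trans ((Real.exp_le_exp.2 hexpo).trans (le_of_eq ?_)))
        rw [Real.exp_add, hgexp, mul_comm]
    _ = (c * M * C + Real.exp (2 * (c * M * C₂))) * g := by ring
    _ ≤ (c * M * C + Real.exp (2 * (c * M * C₂))) * (C₃ * tail G x) := by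
        gcongr
        exact hG₃ x hx
    _ = _ := by ring

lemma IsFixedPointSolution.tendsto_tailOf_partialSum_div (hX : IsFixedPointSolution P A B X)
    {G : Measure ℝ} [IsProbabilityMeasure G] (hG : DominantlyVarying G)
    (hB : Tendsto (fun x => tailOf P (B 0) x / tail G x) atTop (𝓝 0)) (n : ℕ) {z : ℝ}
    (hz : 0 < z) :
    Tendsto (fun x => tailOf P (partialSum B n) (z * x) / tail G x) atTop (𝓝 0) := by
  have hpos := hG.tail_pos
  -- With `n + 1` in place of `n`, `n` summands of size at most `l x` stay strictly below `z x`, and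
  -- `n = 0` needs no separate treatment.
  set l := z / (n + 1) with hl
  have hl0 : 0 < l := by positivity
  obtain ⟨C, hC, hGC⟩ := hG.tail_mul_le hl0
  have hlim : Tendsto (fun x => n * C * (tailOf P (B 0) (l * x) / tail G (l * x))) atTop
      (𝓝 (n * C * 0)) :=
    (hB.comp (tendsto_id.const_mul_atTop hl0)).const_mul _
  rw [mul_zero] at hlim
  refine squeeze_zero' (Eventually.of_forall fun x =>
    div_nonneg (tailOf_nonneg _ _ _) (tail_nonneg _ _)) ?_ hlim
  filter_upwards [eventually_gt_atTop 0] with x hx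
  have hempty : {ω | z * x ≤ ∑ i ∈ Finset.range n, min (B i ω : ℝ) (l * x)} = ∅ := by
    ext ω
    simp only [mem_ofPred_eq, mem_empty_iff_false, iff_false, not_le]
    calc _ ≤ ∑ _i ∈ Finset.range n, l * x := Finset.sum_le_sum fun i _ => min_le_right _ _
      _ = n * (l * x) := by simp
      _ < (n + 1) * (l * x) := by
          have : 0 < l * x := by positivity
          linarith
      _ = z * x := by rw [hl]; field_simp
  have h1 := hX.tailOf_partialSum_le n (l * x) (z * x)
  rw [hempty, measureReal_empty, add_zero] at h1
  have hp := hpos x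
  have hlp := hpos (l * x)
  have ht := tailOf_nonneg P (B 0) (l * x)
  rw [div_le_iff₀ hp]
  refine h1.trans ?_
  have h2 : 1 ≤ C * tail G x / tail G (l * x) := (one_le_div hlp).2 (hGC x hx)
  calc n * tailOf P (B 0) (l * x)
      ≤ n * tailOf P (B 0) (l * x) * (C * tail G x / tail G (l * x)) :=
        le_mul_of_one_le_right (by positivity) h2
    _ = _ := by ring

/-- A random sum with too few summands is negligible. -/
lemma IsFixedPointSolution.tendsto_prob_few_summands (hX : IsFixedPointSolution P A B X)
    {G : Measure ℝ} [IsProbabilityMeasure G] (hG : DominantlyVarying G) {b c z C : ℝ}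
    (hb0 : 0 < b) (hb : ∫⁻ ω, (B 0 ω : ENNReal) ∂P = ENNReal.ofReal b) (hC : 0 < C)
    (hBG : ∀ t, 0 < t → t * tailOf P (B 0) t ≤ C * tail G t)
    (hB : Tendsto (fun x => tailOf P (B 0) x / tail G x) atTop (𝓝 0))
    (hc : 0 < c) (hcz : c * b < z) :
    Tendsto (fun x => P.real {ω | (X ω : ℝ) ≤ c * x ∧ z * x < (partialSum B (X ω) ω : ℝ)} /
      tail G x) atTop (𝓝 0) := by
  classical
  have hpos := hG.tail_pos
  have hz : 0 < z := (by positivity : 0 < c * b).trans hcz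
  obtain ⟨C', hC', hunif⟩ := hX.exists_uniform_bound hG hb0 hb hC hBG hc hcz
  have hsum : Summable fun n : ℕ => C' * P.real {ω | X ω = n} := by
    have := (hX.hasSum_prob fun _ => True).summable
    simp only [if_true, mul_one] at this
    exact this.mul_left _
  -- Dominated convergence over `n`: each fixed `n` is negligible since the tail of `B` is, and the
  -- uniform bound dominates by `C' P(X = n)`.
  have h : Tendsto (fun x : ℝ => ∑' n : ℕ, P.real {ω | X ω = n} *
      (if (n : ℝ) ≤ c * x then tailOf P (partialSum B n) (z * x) else 0) / tail G x) atTop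
      (𝓝 (∑' _ : ℕ, (0 : ℝ))) := by
    refine tendsto_tsum_of_dominated_convergence hsum (fun n => ?_) ?_
    · have h1 := (hX.tendsto_tailOf_partialSum_div hG hB n hz).const_mul (P.real {ω | X ω = n})
      rw [mul_zero] at h1
      refine h1.congr' ?_
      filter_upwards [(tendsto_id.const_mul_atTop hc).eventually_ge_atTop (n : ℝ)] with x hx
      rw [if_pos (show (n : ℝ) ≤ c * x from hx), mul_div_assoc]
    · filter_upwards [eventually_gt_atTop 0] with x hx n
      have hp := hpos x
      have hite : (if (n : ℝ) ≤ c * x then tailOf P (partialSum B n) (z * x) else 0) ≤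
          C' * tail G x := by
        split_ifs with hn
        · exact hunif x hx n hn
        · positivity
      have hite0 : 0 ≤ (if (n : ℝ) ≤ c * x then tailOf P (partialSum B n) (z * x) else 0) := by
        split_ifs
        · exact tailOf_nonneg _ _ _
        · exact le_rfl
      rw [Real.norm_of_nonneg (by positivity), div_le_iff₀ hp]
      calc _ ≤ P.real {ω | X ω = n} * (C' * tail G x) := by gcongr
        _ = _ := by ring
  rw [tsum_zero] at h
  refine h.congr fun x => ?_
  rw [tsum_div_const]
  congr 1
  exact (hX.hasSum_randomSum (fun n => (n : ℝ) ≤ c * x) (z * x)).tsum_eq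

/-- A weak law of large numbers with rate, for the lower deviations of the partial sums. -/
lemma IsFixedPointSolution.exists_lower_deviation (hX : IsFixedPointSolution P A B X) {b c : ℝ}
    (hb0 : 0 < b) (hb : ∫⁻ ω, (B 0 ω : ENNReal) ∂P = ENNReal.ofReal b) (hc : 0 < c)
    (hcb : 1 < c * b) :
    ∃ C : ℝ, 0 ≤ C ∧ ∀ x, 0 < x → ∀ n : ℕ, c * x < n →
      1 - C / x ≤ tailOf P (partialSum B n) x := by
  obtain ⟨hint, hval⟩ := integral_cast_eq (hX.measurable_B 0) hb0 hb
  have hmeas : ∀ M : ℝ, Measurable fun k : ℕ => min (k : ℝ) M := fun M => by fun_prop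
  -- A truncation level `M` with mean still above `1 / c` gives summands of finite variance, so
  -- Chebyshev yields the rate `1 / x`, which is summable along `cⁿ x`.
  have hlim : Tendsto (fun M : ℝ => ∫ ω, min (B 0 ω : ℝ) M ∂P) atTop (𝓝 b) := by
    rw [← hval]
    refine tendsto_integral_filter_of_dominated_convergence (fun ω => (B 0 ω : ℝ))
      (Eventually.of_forall fun M =>
        ((hmeas M).comp (hX.measurable_B 0)).aestronglyMeasurable) ?_ hint ?_
    · filter_upwards [eventually_ge_atTop 0] with M hM
      refine Eventually.of_forall fun ω => ?_
      rw [Real.norm_of_nonneg (le_min (by positivity) hM)]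
      exact min_le_left _ _
    · refine Eventually.of_forall fun ω => tendsto_const_nhds.congr' ?_
      filter_upwards [eventually_ge_atTop (B 0 ω : ℝ)] with M hM
      exact (min_eq_left hM).symm
  have hcb' : 1 / c < b := by rwa [div_lt_iff₀ hc, mul_comm]
  obtain ⟨M, hMb, hM0⟩ := ((hlim.eventually_const_lt hcb').and (eventually_ge_atTop 0)).exists
  set D : ℕ → Ω → ℝ := fun i ω => min (B i ω : ℝ) M with hD
  have hDm : ∀ i, Measurable (D i) := fun i => (hmeas M).comp (hX.measurable_B i)
  have hDid : ∀ i, IdentDistrib (D i) (D 0) P P := fun i => (hX.identDistrib_B i).comp (hmeas M)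
  have hDind : iIndepFun D P := hX.iIndep_B.comp (fun _ k => min (k : ℝ) M) fun _ => hmeas M
  have hDabs : ∀ i ω, |D i ω| ≤ M := fun i ω => by
    rw [abs_of_nonneg (le_min (by positivity) hM0)]; exact min_le_right _ _
  have hDL : ∀ i, MemLp (D i) 2 P := fun i =>
    MemLp.of_bound (hDm i).aestronglyMeasurable M (Eventually.of_forall (hDabs i))
  set m := ∫ ω, D 0 ω ∂P with hm
  set κ := m - 1 / c with hκ
  have hκ0 : 0 < κ := sub_pos.2 hMb
  set V := variance (D 0) P with hV
  have hV0 : 0 ≤ V := variance_nonneg _ _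
  refine ⟨V / (c * κ ^ 2), by positivity, fun x hx n hn => ?_⟩
  have hn0 : (0 : ℝ) < n := (by positivity : 0 < c * x).trans hn
  have hmean : ∫ ω, (∑ i ∈ Finset.range n, D i) ω ∂P = n * m := by
    simp only [Finset.sum_apply]
    rw [integral_finsetSum _ fun i _ => (hDL i).integrable one_le_two,
      Finset.sum_congr rfl fun i _ => (hDid i).integral_eq]
    simp [hm]
  have hvar : variance (∑ i ∈ Finset.range n, D i) P = n * V := by
    rw [IndepFun.variance_sum (fun i _ => hDL i) fun i _ j _ hij => hDind.indepFun hij,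
      Finset.sum_congr rfl fun i _ => (hDid i).variance_eq]
    simp [hV]
  have hcheb := meas_ge_le_variance_div_sq (μ := P) (X := ∑ i ∈ Finset.range n, D i)
    (memLp_finsetSum' _ fun i _ => hDL i) (c := n * κ) (by positivity)
  rw [hmean, hvar] at hcheb
  have hcompl : P.real {ω | x < (partialSum B n ω : ℝ)}ᶜ ≤ V / (c * κ ^ 2) / x := by
    calc _ ≤ P.real {ω | n * κ ≤ |(∑ i ∈ Finset.range n, D i) ω - n * m|} := by
          refine measureReal_mono fun ω hω => ?_
          have h1 : (partialSum B n ω : ℝ) ≤ x := not_lt.1 hω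
          have h2 : (∑ i ∈ Finset.range n, D i) ω ≤ (partialSum B n ω : ℝ) := by
            rw [Finset.sum_apply, partialSum, Nat.cast_sum]
            exact Finset.sum_le_sum fun i _ => min_le_left _ _
          have h3 : x < n * (1 / c) := by
            rw [mul_one_div, lt_div_iff₀ hc]; linarith
          have h4 : n * κ ≤ -((∑ i ∈ Finset.range n, D i) ω - n * m) := by
            rw [hκ]; linarith
          exact h4.trans (neg_le_abs _)
      _ ≤ n * V / (n * κ) ^ 2 :=
          ENNReal.toReal_le_of_le_ofReal (by positivity) hcheb
      _ = V / κ ^ 2 / n := by field_simp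
      _ ≤ V / κ ^ 2 / (c * x) := by gcongr
      _ = _ := by field_simp
  rw [measureReal_compl (measurableSet_lt measurable_const
    (by have := measurable_partialSum hX.measurable_B n; fun_prop))] at hcompl
  rw [probReal_univ] at hcompl
  have h : tailOf P (partialSum B n) x = P.real {ω | x < (partialSum B n ω : ℝ)} := rfl
  rw [h]
  linarith

end Bounds

/-! ### The two one-step recursions for the tail of `X` -/

section Asymptotics

variable {Ω : Type*} [MeasurableSpace Ω] {P : Measure Ω} [IsProbabilityMeasure P]
  {A : Ω → ℕ} {B : ℕ → Ω → ℕ} {X : Ω → ℕ}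

lemma IsFixedPointSolution.randomSum_tail_le (hX : IsFixedPointSolution P A B X) (x : ℝ) :
    P.real {ω | x < (partialSum B (X ω) ω : ℝ)} ≤ tailOf P X x := by
  rw [hX.tailOf_eq]
  refine measureReal_mono fun ω hω => ?_
  have h1 : x < (partialSum B (X ω) ω : ℝ) := hω
  have h2 : (0 : ℝ) ≤ A ω := by positivity
  change x < (A ω : ℝ) + (partialSum B (X ω) ω : ℝ)
  linarith

lemma IsFixedPointSolution.upper_bound (hX : IsFixedPointSolution P A B X)
    {G : Measure ℝ} [IsProbabilityMeasure G] (hGD : DominantlyVarying G) (hGL : LongTailed G)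
    {b c c₁ ε C : ℝ} (hb0 : 0 < b) (hb : ∫⁻ ω, (B 0 ω : ENNReal) ∂P = ENNReal.ofReal b)
    (hc₁ : 0 < c₁) (hA : Tendsto (fun x => tailOf P A x / tail G x) atTop (𝓝 c₁))
    (hB : Tendsto (fun x => tailOf P (B 0) x / tail G x) atTop (𝓝 0))
    (hC : 0 < C) (hBG : ∀ t, 0 < t → t * tailOf P (B 0) t ≤ C * tail G t)
    (hsum : ∀ x, 0 < x → Summable fun n : ℕ => tail G (c ^ n * x))
    (hc : 1 < c) (hcb : c * b < 1) (hε : 0 < ε) :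
    ∀ᶠ x in atTop, tailOf P X x ≤ (1 + ε) * c₁ * tailSeries G c x := by
  have hpos := hGD.tail_pos
  obtain ⟨z, hz, hz1⟩ := exists_between hcb
  have hη : 0 < 1 - z := by linarith
  obtain ⟨C₂, hC₂, hG₂⟩ := hGD.tail_mul_le hη
  have hXlim := tailOf_tendsto_zero P hX.measurable_X
  -- The constant makes the event that `A` and the sum are both large cost `2 c₁ C₂ ε / (8 C₂) = ε
  -- c₁ / 4`; with `ε/2` from the shift of `A` and `ε/4` from few summands the total is `ε c₁`.
  obtain ⟨h, hh⟩ := (hXlim.eventually_lt_const (show 0 < ε / (8 * C₂) by positivity)).exists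
  -- Long-tailedness lets the fixed shift `h` be ignored.
  have hshift : Tendsto (fun x => tailOf P A (x - h) / tail G x) atTop (𝓝 c₁) := by
    have h1 : Tendsto (fun x => tailOf P A (x - h) / tail G (x - h)) atTop (𝓝 c₁) :=
      hA.comp (tendsto_atTop_add_const_right _ (-h) tendsto_id)
    have h2 := h1.mul (hGL (-h))
    rw [mul_one] at h2
    refine h2.congr fun x => ?_
    change _ * (tail G (x + -h) / tail G x) = _
    rw [← sub_eq_add_neg, div_mul_div_cancel₀ (hpos _).ne']
  have hfew := hX.tendsto_prob_few_summands hGD hb0 hb hC hBG hB (by linarith : 0 < c) hz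
  have hAη : ∀ᶠ x in atTop, tailOf P A ((1 - z) * x) ≤ 2 * c₁ * tail G ((1 - z) * x) := by
    have := (hA.comp (tendsto_id.const_mul_atTop hη)).eventually_lt_const
      (show c₁ < 2 * c₁ by linarith)
    filter_upwards [this] with x hx
    exact ((div_lt_iff₀ (hpos _)).1 hx).le
  have hrec : ∀ᶠ x in atTop, tailOf P X x ≤ (1 + ε) * c₁ * tail G x + tailOf P X (c * x) := by
    filter_upwards [hshift.eventually_lt_const (show c₁ < (1 + ε / 2) * c₁ by nlinarith),
      hfew.eventually_lt_const (show 0 < ε / 4 * c₁ by positivity), hAη,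
      eventually_gt_atTop 0] with x hx1 hx2 hx3 hx
    rw [div_lt_iff₀ (hpos x)] at hx1 hx2
    have hand : P.real {ω | (1 - z) * x < (A ω : ℝ) ∧ h < (partialSum B (X ω) ω : ℝ)} ≤
        ε / 4 * c₁ * tail G x := by
      rw [hX.prob_and]
      have hp := hpos x
      calc _ ≤ 2 * c₁ * (C₂ * tail G x) * (ε / (8 * C₂)) := by
            gcongr
            · refine hx3.trans ?_
              have := hG₂ x hx
              gcongr
            · exact (hX.randomSum_tail_le h).trans hh.le
        _ = _ := by field_simp; ring
    -- Outside the last two events the sum is at most `z x`, so `A > (1 - z) x`; outside the second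
    -- the sum is then at most `h`, which forces the first.
    have hincl : {ω | x < (A ω : ℝ) + (partialSum B (X ω) ω : ℝ)} ⊆
        {ω | x - h < (A ω : ℝ)} ∪
        ({ω | (1 - z) * x < (A ω : ℝ) ∧ h < (partialSum B (X ω) ω : ℝ)} ∪
        ({ω | (X ω : ℝ) ≤ c * x ∧ z * x < (partialSum B (X ω) ω : ℝ)} ∪
        {ω | c * x < (X ω : ℝ)})) := by
      intro ω hω
      simp only [mem_union, mem_ofPred_eq] at hω ⊢
      by_contra hcon
      push Not at hcon
      obtain ⟨h1, h2, h3, h4⟩ := hcon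
      have h5 := h3 h4
      have h6 : (1 - z) * x < (A ω : ℝ) := by linarith
      linarith [h2 h6]
    rw [hX.tailOf_eq]
    have := (measureReal_mono hincl (measure_ne_top P _)).trans ((measureReal_union_le _ _).trans
      (add_le_add_right ((measureReal_union_le _ _).trans
        (add_le_add_right (measureReal_union_le _ _) _)) _))
    refine this.trans ?_
    have e1 : P.real {ω | x - h < (A ω : ℝ)} = tailOf P A (x - h) := rfl
    have e2 : P.real {ω | c * x < (X ω : ℝ)} = tailOf P X (c * x) := rfl
    rw [e1, e2]
    linarith
  obtain ⟨x₁, hx₁⟩ := eventually_atTop.1 hrec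
  filter_upwards [eventually_ge_atTop (max x₁ 1)] with x hx
  exact le_tailSeries_of_recursion hc (by positivity : 0 < max x₁ 1) (by positivity) hXlim hsum
    (fun y hy => hx₁ y ((le_max_left _ _).trans hy)) hx

lemma IsFixedPointSolution.lower_recursion (hX : IsFixedPointSolution P A B X) {b c : ℝ}
    (hb0 : 0 < b) (hb : ∫⁻ ω, (B 0 ω : ENNReal) ∂P = ENNReal.ofReal b) (hc : 0 < c)
    (hcb : 1 < c * b) :
    ∃ D : ℝ, 0 ≤ D ∧ ∀ x, 0 < x →
      tailOf P A x + (1 - (tailOf P A x + D / x)) * tailOf P X (c * x) ≤ tailOf P X x := by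
  classical
  obtain ⟨D, hD, hdev⟩ := hX.exists_lower_deviation hb0 hb hc hcb
  refine ⟨D, hD, fun x hx => ?_⟩
  set r := P.real {ω | x < (partialSum B (X ω) ω : ℝ)} with hr
  have hrlow : (1 - D / x) * tailOf P X (c * x) ≤ r := by
    refine le_trans ?_ (measureReal_mono (s₁ := {ω | c * x < (X ω : ℝ) ∧
      x < (partialSum B (X ω) ω : ℝ)}) fun ω hω => hω.2)
    refine hasSum_le (fun n => ?_) ((hX.hasSum_prob fun n => c * x < (n : ℝ)).mul_left (1 - D / x))
      (hX.hasSum_randomSum (fun n => c * x < (n : ℝ)) x)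
    by_cases hn : c * x < (n : ℝ)
    · rw [if_pos hn, if_pos hn, mul_one, mul_comm]
      exact mul_le_mul_of_nonneg_left (hdev x hx n hn) measureReal_nonneg
    · simp [hn]
  -- Both terms are non-negative, so it suffices that one exceeds `x`; inclusion-exclusion and
  -- independence give the product.
  have hunion : tailOf P A x + r - tailOf P A x * r ≤ tailOf P X x := by
    have hmA : MeasurableSet {ω | x < (A ω : ℝ)} :=
      measurableSet_lt measurable_const (by have := hX.measurable_A; fun_prop)
    have h1 := measureReal_union_add_inter' (μ := P) hmA
      (t := {ω | x < (partialSum B (X ω) ω : ℝ)})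
    have h2 : P.real ({ω | x < (A ω : ℝ)} ∩ {ω | x < (partialSum B (X ω) ω : ℝ)}) =
        tailOf P A x * r := hX.prob_and x x
    have h3 : P.real ({ω | x < (A ω : ℝ)} ∪ {ω | x < (partialSum B (X ω) ω : ℝ)}) ≤
        tailOf P X x := by
      rw [hX.tailOf_eq]
      refine measureReal_mono fun ω hω => ?_
      have hA0 : (0 : ℝ) ≤ A ω := by positivity
      have hS0 : (0 : ℝ) ≤ partialSum B (X ω) ω := by positivity
      change x < (A ω : ℝ) + (partialSum B (X ω) ω : ℝ)
      rcases hω with hω | hω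
      · have : x < (A ω : ℝ) := hω
        linarith
      · have : x < (partialSum B (X ω) ω : ℝ) := hω
        linarith
    rw [h2] at h1
    have e1 : P.real {ω | x < (A ω : ℝ)} = tailOf P A x := rfl
    rw [e1, ← hr] at h1
    linarith
  have ha0 := tailOf_nonneg P A x
  have ha1 := tailOf_le_one P A x
  have hf0 := tailOf_nonneg P X (c * x)
  have hDx : 0 ≤ D / x := by positivity
  have h1 : (1 - tailOf P A x) * ((1 - D / x) * tailOf P X (c * x)) ≤ (1 - tailOf P A x) * r :=
    mul_le_mul_of_nonneg_left hrlow (by linarith)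
  nlinarith [mul_nonneg (mul_nonneg ha0 hDx) hf0]

end Asymptotics

end HeavyTail

/-! ### Assembly -/

theorem mainTheorem2 {Ω : Type*} [MeasurableSpace Ω] (P : Measure Ω) [IsProbabilityMeasure P]
    (A : Ω → ℕ) (B : ℕ → Ω → ℕ) (X : Ω → ℕ)
    (hX : HeavyTail.IsFixedPointSolution P A B X)
    (G : Measure ℝ) [IsProbabilityMeasure G]
    (b c₁ : ℝ)
    (hA0 : 0 < P {ω | A ω = 0}) (hA1 : P {ω | A ω = 0} < 1)
    (hB1 : P {ω | B 0 ω = 0} < 1)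
    (hb : ∫⁻ ω, (B 0 ω : ENNReal) ∂P = ENNReal.ofReal b) (hb0 : 0 < b) (hb1 : b < 1)
    (hGD : HeavyTail.DominantlyVarying G) (hGL : HeavyTail.LongTailed G)
    (hc₁ : 0 < c₁)
    (hA : Tendsto (fun x => HeavyTail.tailOf P A x / HeavyTail.tail G x) atTop (𝓝 c₁))
    (hB : Tendsto (fun x => HeavyTail.tailOf P (B 0) x / HeavyTail.tail G x) atTop (𝓝 0))
    (ha : ∫⁻ ω, (A ω : ENNReal) ∂P = ⊤)
    (hlog : Integrable (fun ω => Real.log (max (A ω : ℝ) 1)) P)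
    (hcase :
      (evariance (fun ω => (B 0 ω : ℝ)) P < ⊤ ∧
        0 < liminf (fun x : ℝ => ((x * HeavyTail.tail G x : ℝ) : EReal)) atTop) ∨
      (HeavyTail.Subexponential
          (HeavyTail.integratedTailDistribution (P.map fun ω => (B 0 ω : ℝ))) ∧
        limsup (fun x : ℝ =>
          ((HeavyTail.tail
              (HeavyTail.integratedTailDistribution (P.map fun ω => (B 0 ω : ℝ))) x /
            HeavyTail.tail G x : ℝ) : EReal)) atTop < ⊤)) :
    (∀ c : ℝ, 1 < c → ∀ x : ℝ, 0 < x → Summable fun n : ℕ => HeavyTail.tail G (c ^ n * x)) ∧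
    (HeavyTail.TailSeriesContinuousAt G (1 / b) →
      HeavyTail.AsympEquiv (HeavyTail.tailOf P X)
        (fun x => c₁ * HeavyTail.tailSeries G (1 / b) x)) ∧
    (HeavyTail.ExtendedRegularlyVarying G →
      HeavyTail.AsympEquiv (HeavyTail.tailOf P X)
        (fun x => c₁ * HeavyTail.tailSeries G (1 / b) x)) ∧
    (∀ α : ℝ, 0 < α → HeavyTail.RegularlyVarying G α →
      HeavyTail.AsympEquiv (HeavyTail.tailOf P X)
        (fun x => c₁ / (1 - b ^ α) * HeavyTail.tail G x)) := by
  open HeavyTail in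
  have hpos := hGD.tail_pos
  have hc₀ : 1 < 1 / b := (one_lt_div hb0).2 hb1
  have hsum : ∀ c : ℝ, 1 < c → ∀ x : ℝ, 0 < x → Summable fun n : ℕ => tail G (c ^ n * x) := by
    intro c hc x hx
    refine summable_of_eventually_le (tail_nonneg G) (v := tailOf P A) (C := 2 / c₁) ?_ hc hx
      (summable_tailOf_of_integrable_log P hlog hc hx)
    filter_upwards [hA.eventually_const_lt (show c₁ / 2 < c₁ by linarith)] with y hy
    rw [lt_div_iff₀ (hpos y)] at hy
    rw [div_mul_eq_mul_div, le_div_iff₀ hc₁]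
    linarith
  obtain ⟨C, hC, hBG⟩ : ∃ C : ℝ, 0 < C ∧ ∀ t, 0 < t → t * tailOf P (B 0) t ≤ C * tail G t := by
    have hBm := hX.measurable_B 0
    rcases hcase with ⟨hvar, hlim⟩ | ⟨-, hlim⟩
    · refine exists_mul_tailOf_le_of_memLp hpos ?_ hlim
      exact (evariance_lt_top_iff_memLp
        (show Measurable fun ω => (B 0 ω : ℝ) by fun_prop).aestronglyMeasurable).1 hvar
    · exact exists_mul_tailOf_le_of_integratedTail hGD hBm hb hb1 hlim
  have hT : ∀ᶠ x in atTop, 0 < tailSeries G (1 / b) x := by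
    filter_upwards [eventually_gt_atTop 0] with x hx
    exact (hpos x).trans_le (tail_le_tailSeries (hsum _ hc₀ x hx))
  have hup : ∀ c, 1 < c → c < 1 / b → ∀ ε, 0 < ε →
      ∀ᶠ x in atTop, tailOf P X x ≤ (1 + ε) * c₁ * tailSeries G c x :=
    fun c hc hcb ε hε => hX.upper_bound hGD hGL hb0 hb hc₁ hA hB hC hBG (hsum c hc) hc
      ((lt_div_iff₀ hb0).1 hcb) hε
  have hlo : ∀ c, 1 / b < c → ∀ ε, 0 < ε → ε < 1 →
      ∀ᶠ x in atTop, (1 - ε) * c₁ * tailSeries G c x ≤ tailOf P X x := by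
    intro c hcb ε hε hε1
    have hc : 1 < c := hc₀.trans hcb
    obtain ⟨D, hD, hrec⟩ := hX.lower_recursion hb0 hb (by linarith) ((div_lt_iff₀ hb0).1 hcb)
    refine tailSeries_le_of_recursion hc hc₁ hε hε1 (hsum c hc) (tailOf_nonneg P X)
      (tailOf_nonneg P A) hpos hA hD ?_
    filter_upwards [eventually_gt_atTop 0] with x hx using hrec x hx
  have hERV : ExtendedRegularlyVarying G →
      AsympEquiv (tailOf P X) (fun x => c₁ * tailSeries G (1 / b) x) := fun h =>
    asympEquiv_of_sandwich hc₁ hT hup hlo (fun _ hε => h.exists_lt hpos hsum hc₀ hε)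
      (fun _ hε hε1 => h.exists_gt hpos hsum hc₀ hε hε1)
  refine ⟨hsum, fun h => ?_, hERV, fun α hα h => ?_⟩
  · exact asympEquiv_of_sandwich hc₁ hT hup hlo (fun _ hε => h.exists_lt hc₀ hT hε)
      (fun _ hε _ => h.exists_gt hT hε)
  -- The quotient of the tail of `X` by `c₁ T_{1/b}`, times the quotient of `T_{1/b}` by the tail of
  -- `G`, has limit `1 / (1 - b ^ α)`.
  · have h1 := hERV (h.extendedRegularlyVarying hα hpos)
    have h2 := h.tendsto_tailSeries_div hα hpos hc₀
    have hbα : (1 / b) ^ (-α) = b ^ α := by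
      rw [one_div, Real.inv_rpow hb0.le, Real.rpow_neg hb0.le, inv_inv]
    rw [hbα] at h2
    have hlt : b ^ α < 1 := Real.rpow_lt_one hb0.le hb1 hα
    have hne : 1 - b ^ α ≠ 0 := by linarith
    have h3 := (h1.mul h2).mul_const (1 - b ^ α)
    rw [one_mul, inv_mul_cancel₀ hne] at h3
    refine h3.congr' ?_
    filter_upwards [hT] with x hx
    have hg := (hpos x).ne'
    have hx' := hx.ne'
    have hc' := hc₁.ne'
    field_simp
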